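/- **Setting.** Let $f,g:\mathbb R^m\times\mathbb R^n\to\mathbb R$ be differentiable, with $\nabla_1 g(x,\cdot)$ and $\nabla_2 g(x,\cdot)$ differentiable for every $x$ (Jacobians $\nabla^2_{12}g$, $\nabla^2_{22}g$), and let $\mu>0$, $L_{f,1},L_{g,1},L_{g,2}>0$, $L_{f,0},C_{f,0}\ge 0$ be such that: $g(x,\cdot)$ is $\mu$-strongly convex for every $x$, where $\mu\le L_{g,1}$ (automatic if $n\ge1$); $\nabla g$ is $L_{g,1}$-Lipschitz; $\nabla^2_{22}g$ and $\nabla^2_{12}g$ are $L_{g,2}$-Lipschitz; $\nabla f$ is $L_{f,1}$-Lipschitz; $\|\nabla_2 f(x,y^*(x))\|\le L_{f,0}$ for all $x$, where $y^*(x)=\arg\min_y g(x,y)$; and $\|\nabla_1 f(x,y)\|\le C_{f,0}$ for all $x,y$. Put $\Phi(x)=f(x,y^*(x))$, assume $\Phi^*=\inf\Phi>-\infty$, and put $u^*(x)=[\nabla^2_{22}g(x,y^*(x))]^{-1}\nabla_2 f(x,y^*(x))$, $\kappa=\max\{L_{g,1},L_{f,1}\}/\mu$, $L_1=L_{f,1}+L_{g,2}L_{f,0}/\mu$.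 **NBO-CG.** From $(x^0,y^0,u^0)$, with step size $\alpha$, for $k=0,1,\dots$: let $v^k$ and $w^k$ be the results of $T+1$ conjugate gradient iterations (stopped earlier if the residual vanishes), started at $0$, for $$\min_v \tfrac12\langle H_kv,v\rangle-\langle\nabla_2g(x^k,y^k),v\rangle,\qquad \min_w \tfrac12\langle H_kw,w\rangle-\langle H_ku^k-\nabla_2f(x^k,y^k),w\rangle,\qquad H_k=\nabla_{22}^2g(x^k,y^k);$$ set $y^{k+1}=y^k-v^k$, $u^{k+1}=u^k-w^k$ and $x^{k+1}=x^k-\alpha\big(\nabla_1f(x^k,y^k)-\nabla^2_{12}g(x^k,y^k)u^k\big)$. **Admissible initial points.** $(x^0,y^0,u^0)$ is admissible if $\|y^0-y^*(x^0)\|\le\min\{\frac{\mu}{2L_{g,2}},\frac1{2\sqrt{L_1}}\}$ and $\|u^0-u^*(x^0)\|\le\min\{\frac{5L_1}{2L_{g,2}},\frac{\sqrt{L_1}}{\mu}\}$. **Initialization.** Given $x^0,y^{0,0},u^{0,0}$ and a step size $0<\beta\le 1/L_{g,1}$, take $N_0$ gradient steps $y\leftarrow y-\beta\nabla_2g(x^0,y)$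 from $y^{0,0}$ to get $y^0$, then $Q_0$ steps $u\leftarrow u-\beta(\nabla_{22}^2g(x^0,y^0)u-\nabla_2f(x^0,y^0))$ from $u^{0,0}$ to get $u^0$. **Claim.** There are constants $a,\tau>0$ depending only on $L_{f,1},L_{g,1},L_{g,2},L_{f,0},C_{f,0}$ and, for all $D,R$ and $\beta\in(0,1/L_{g,1}]$, a constant $C>0$ depending only on these, $D$, $R$ and $\beta$ (neither on $\mu$, nor on $m,n,f,g$ or the initial point), such that for $\alpha=a\kappa^{-3}$ and $T=\lceil\tau\sqrt\kappa\,(1+\log\kappa)\rceil$ the following holds. $\Phi$ is differentiable, and: 1. (Rate.) From every admissible initial point and for every $K\ge1$, $$\min_{0\le k\le K-1}\|\nabla\Phi(x^k)\|^2\le\frac{2\Phi(x^0)-2\Phi^*+4}{\alpha K},$$ and the right-hand side may be replaced by $C\kappa^3/K$ if $\Phi(x^0)-\Phi^*\le D$. 2. (Complexity.) For every $\varepsilon\in(0,1]$ and every admissible initial point with $\Phi(x^0)-\Phi^*\le D$, some number $K\le C\kappa^3/\varepsilon$ of outer iterations achieves $\min_{0\le k\le K-1}\|\nabla\Phi(x^k)\|^2\le\varepsilon$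 with at most $C\kappa^3/\varepsilon$ gradient computations, at most $C\kappa^3/\varepsilon$ Jacobian-vector products, and at most $C\kappa^{3.5}(1+\log\kappa)/\varepsilon$ Hessian-vector products. 3. (Initialization included.) There are $N_0,Q_0\le C\kappa(1+\log\kappa)$, depending on $\mu$ and the constants only, such that whenever $\|\nabla_2g(x^0,y^{0,0})\|\le R$ and $\|u^{0,0}\|\le R$ the initialization yields an admissible point; if moreover $\Phi(x^0)-\Phi^*\le D$, the bounds of item 2 also hold for the total cost of the initialization and the NBO-CG iterations started at that point. -/

import Mathlib

open Set

noncomputable section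

namespace Bilevel

/-- `ℝ^d` with the Euclidean norm. -/
abbrev Vec (d : ℕ) : Type := EuclideanSpace ℝ (Fin d)

/-- `ℝ^m × ℝ^n` with the Euclidean norm `‖(x, y)‖² = ‖x‖² + ‖y‖²`. -/
abbrev Joint (m n : ℕ) : Type := WithLp 2 (Vec m × Vec n)

/-- The point `(x, y)`. -/
abbrev pt {m n : ℕ} (x : Vec m) (y : Vec n) : Joint m n := WithLp.toLp 2 (x, y)

/-! ### Derivatives -/

/-- `∇₁ h(x, y)`. -/
def grad1 {m n : ℕ} (h : Joint m n → ℝ) (x : Vec m) (y : Vec n) : Vec m :=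
  (gradient h (pt x y)).fst

/-- `∇₂ h(x, y)`. -/
def grad2 {m n : ℕ} (h : Joint m n → ℝ) (x : Vec m) (y : Vec n) : Vec n :=
  (gradient h (pt x y)).snd

/-- `∇²₁₂ h(x, y)`: the Jacobian of `y ↦ ∇₁ h(x, y)`. -/
def jac12 {m n : ℕ} (h : Joint m n → ℝ) (x : Vec m) (y : Vec n) : Vec n →L[ℝ] Vec m :=
  fderiv ℝ (fun y' => grad1 h x y') y

/-- `∇²₂₂ h(x, y)`: the Hessian of `h(x, ·)`, i.e. the Jacobian of `y ↦ ∇₂ h(x, y)`. -/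
def hess22 {m n : ℕ} (h : Joint m n → ℝ) (x : Vec m) (y : Vec n) : Vec n →L[ℝ] Vec n :=
  fderiv ℝ (fun y' => grad2 h x y') y

/-! ### The bilevel problem `min_x f(x, y*(x))`, `y*(x) = argmin_y g(x, y)` -/

/-- `y*(x)`, the minimizer of `g(x, ·)`. -/
def yStar {m n : ℕ} (g : Joint m n → ℝ) (x : Vec m) : Vec n :=
  Classical.epsilon (fun y => ∀ z, g (pt x y) ≤ g (pt x z))

/-- `u*(x) = [∇²₂₂ g(x, y*(x))]⁻¹ ∇₂ f(x, y*(x))`. -/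
def uStar {m n : ℕ} (f g : Joint m n → ℝ) (x : Vec m) : Vec n :=
  (hess22 g x (yStar g x)).inverse (grad2 f x (yStar g x))

/-- The objective `Φ(x) = f(x, y*(x))`. -/
def Phi {m n : ℕ} (f g : Joint m n → ℝ) (x : Vec m) : ℝ := f (pt x (yStar g x))

/-- The optimal value `Φ* = inf_x Φ(x)`. -/
def PhiStar {m n : ℕ} (f g : Joint m n → ℝ) : ℝ := ⨅ x, Phi f g x

/-- The standing assumptions on `f` and `g`. Matrices are measured in the operator norm, which is
at most the Frobenius norm. -/
structure Assumptions {m n : ℕ} (f g : Joint m n → ℝ) (μ Lf1 Lg1 Lg2 Lf0 Cf0 : ℝ) : Prop where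
  f_diff : Differentiable ℝ f
  g_diff : Differentiable ℝ g
  g_diff2 : ∀ x, Differentiable ℝ (fun y => gradient g (pt x y))
  g_strong : ∀ x, StrongConvexOn univ μ (fun y => g (pt x y))
  g_grad_lip : ∀ p q, ‖gradient g p - gradient g q‖ ≤ Lg1 * ‖p - q‖
  g_hess_lip : ∀ x y x' y', ‖hess22 g x y - hess22 g x' y'‖ ≤ Lg2 * ‖pt x y - pt x' y'‖
  g_jac_lip : ∀ x y x' y', ‖jac12 g x y - jac12 g x' y'‖ ≤ Lg2 * ‖pt x y - pt x' y'‖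
  f_grad_lip : ∀ p q, ‖gradient f p - gradient f q‖ ≤ Lf1 * ‖p - q‖
  f_grad2_bound : ∀ x, ‖grad2 f x (yStar g x)‖ ≤ Lf0
  f_grad1_bound : ∀ x y, ‖grad1 f x y‖ ≤ Cf0

/-! ### Computations that count their oracle calls -/

/-- Numbers of gradient computations, Jacobian-vector products and Hessian-vector products. -/
structure Cost where
  grad : ℕ
  jac : ℕ
  hess : ℕ

/-- A computed value together with the number of oracle calls spent on it. -/
structure Counted (A : Type) where
  val : A
  cost : Cost

instance : Monad Counted where
  pure a := ⟨a, ⟨0, 0, 0⟩⟩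
  bind c k :=
    ⟨(k c.val).val,
      ⟨c.cost.grad + (k c.val).cost.grad, c.cost.jac + (k c.val).cost.jac,
        c.cost.hess + (k c.val).cost.hess⟩⟩

/-- Oracle for `∇₁ h(x, y)`: one gradient computation. -/
def askGrad1 {m n : ℕ} (h : Joint m n → ℝ) (x : Vec m) (y : Vec n) : Counted (Vec m) :=
  ⟨grad1 h x y, ⟨1, 0, 0⟩⟩

/-- Oracle for `∇₂ h(x, y)`: one gradient computation. -/
def askGrad2 {m n : ℕ} (h : Joint m n → ℝ) (x : Vec m) (y : Vec n) : Counted (Vec n) :=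
  ⟨grad2 h x y, ⟨1, 0, 0⟩⟩

/-- Oracle for `∇²₁₂ h(x, y) u`: one Jacobian-vector product. -/
def askJac {m n : ℕ} (h : Joint m n → ℝ) (x : Vec m) (y u : Vec n) : Counted (Vec m) :=
  ⟨jac12 h x y u, ⟨0, 1, 0⟩⟩

/-- Oracle for `∇²₂₂ h(x, y) u`: one Hessian-vector product. -/
def askHess {m n : ℕ} (h : Joint m n → ℝ) (x : Vec m) (y u : Vec n) : Counted (Vec n) :=
  ⟨hess22 h x y u, ⟨0, 0, 1⟩⟩

/-! ### Conjugate gradient -/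

/-- Current solution `v`, residual `r = b - H v` and search direction `p`. -/
structure CGState (n : ℕ) where
  sol : Vec n
  res : Vec n
  dir : Vec n

open Classical in
/-- One iteration of the conjugate gradient method for `H v = b`; it stops once the residual
vanishes. -/
def cgStep {n : ℕ} (H : Vec n → Counted (Vec n)) (s : CGState n) : Counted (CGState n) :=
  if s.res = 0 then pure s
  else do
    let q ← H s.dir
    let a : ℝ := ‖s.res‖ ^ 2 / inner ℝ s.dir q
    let r : Vec n := s.res - a • q
    let b : ℝ := ‖r‖ ^ 2 / ‖s.res‖ ^ 2
    pure ⟨s.sol + a • s.dir, r, r + b • s.dir⟩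

/-- `N` iterations of conjugate gradient. -/
def cgIter {n : ℕ} (H : Vec n → Counted (Vec n)) (s : CGState n) : ℕ → Counted (CGState n)
  | 0 => pure s
  | N + 1 => do
    let s' ← cgIter H s N
    cgStep H s'

/-- Conjugate gradient for `min_v ½⟨H v, v⟩ - ⟨b, v⟩`: starting from `v^{-1} = 0` it computes
`v^0, …, v^T` (thus `T + 1` iterations) and returns `v^T`. -/
def cg {n : ℕ} (H : Vec n → Counted (Vec n)) (b : Vec n) (T : ℕ) : Counted (Vec n) := do
  let s ← cgIter H ⟨0, b, b⟩ (T + 1)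
  pure s.sol

/-! ### NBO-CG -/

/-- An iterate `(x^k, y^k, u^k)`. -/
structure Iterate (m n : ℕ) where
  x : Vec m
  y : Vec n
  u : Vec n

/-- One outer iteration of NBO-CG with step size `α`. -/
def nboStep {m n : ℕ} (f g : Joint m n → ℝ) (α : ℝ) (T : ℕ) (s : Iterate m n) :
    Counted (Iterate m n) := do
  let dy ← askGrad2 g s.x s.y
  let Hu ← askHess g s.x s.y s.u
  let f2 ← askGrad2 f s.x s.y
  let v ← cg (askHess g s.x s.y) dy T
  let w ← cg (askHess g s.x s.y) (Hu - f2) T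
  let f1 ← askGrad1 f s.x s.y
  let Ju ← askJac g s.x s.y s.u
  pure ⟨s.x - α • (f1 - Ju), s.y - v, s.u - w⟩

/-- The iterate `(x^k, y^k, u^k)` of NBO-CG started at `s`, with the cost of the first `k` outer
iterations. -/
def nboCG {m n : ℕ} (f g : Joint m n → ℝ) (α : ℝ) (T : ℕ) (s : Iterate m n) :
    ℕ → Counted (Iterate m n)
  | 0 => pure s
  | k + 1 => do
    let s' ← nboCG f g α T s k
    nboStep f g α T s'

/-! ### Initialization -/

/-- The set of admissible initial points `(x⁰, y⁰, u⁰)`, with `L₁ = L_{f,1} + L_{g,2} L_{f,0} / μ`. -/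
def box {m n : ℕ} (f g : Joint m n → ℝ) (μ Lf1 Lg2 Lf0 : ℝ) : Set (Iterate m n) :=
  {s | ‖s.y - yStar g s.x‖ ≤ min (μ / (2 * Lg2)) (1 / (2 * √(Lf1 + Lg2 * (Lf0 / μ)))) ∧
    ‖s.u - uStar f g s.x‖ ≤
      min (5 * (Lf1 + Lg2 * (Lf0 / μ)) / (2 * Lg2)) (√(Lf1 + Lg2 * (Lf0 / μ)) / μ)}

/-- `N` gradient descent steps on `g(x, ·)` with step size `β`. -/
def initY {m n : ℕ} (g : Joint m n → ℝ) (β : ℝ) (x : Vec m) (y : Vec n) : ℕ → Counted (Vec n)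
  | 0 => pure y
  | N + 1 => do
    let y' ← initY g β x y N
    let d ← askGrad2 g x y'
    pure (y' - β • d)

/-- `Q` gradient descent steps with step size `β` on `½⟨∇²₂₂ g(x, y) u, u⟩ - ⟨b, u⟩`. -/
def initU {m n : ℕ} (g : Joint m n → ℝ) (β : ℝ) (x : Vec m) (y b u : Vec n) :
    ℕ → Counted (Vec n)
  | 0 => pure u
  | Q + 1 => do
    let u' ← initU g β x y b u Q
    let Hu ← askHess g x y u'
    pure (u' - β • (Hu - b))

/-- The initialization procedure: gradient descent for `y⁰`, then for `u⁰`. -/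
def initBox {m n : ℕ} (f g : Joint m n → ℝ) (β : ℝ) (N Q : ℕ) (s : Iterate m n) :
    Counted (Iterate m n) := do
  let y ← initY g β s.x s.y N
  let b ← askGrad2 f s.x y
  let u ← initU g β s.x y b s.u Q
  pure ⟨s.x, y, u⟩

/-- The complete method: initialization followed by `K` outer iterations of NBO-CG. -/
def fullNboCG {m n : ℕ} (f g : Joint m n → ℝ) (β : ℝ) (N Q : ℕ) (α : ℝ) (T : ℕ)
    (s : Iterate m n) (K : ℕ) : Counted (Iterate m n) := do
  let s0 ← initBox f g β N Q s
  nboCG f g α T s0 K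

/-- `min_{0 ≤ k ≤ K-1} ‖∇Φ(x^k)‖² ≤ B` for the NBO-CG iterates started at `s`. -/
def minGradLE {m n : ℕ} (f g : Joint m n → ℝ) (α : ℝ) (T : ℕ) (s : Iterate m n) (K : ℕ)
    (B : ℝ) : Prop :=
  ∃ k < K, ‖gradient (Phi f g) (nboCG f g α T s k).val.x‖ ^ 2 ≤ B

end Bilevel

end

/-! Write L₁ for `Lf1 + Lg2 * (Lf0 / μ)` and d for the update direction in x. One outer iteration is
an inexact Newton step towards `yStar`, an inexact linear solve towards `uStar`, and a step along
the approximate hypergradient d. The proof rests on four facts.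

Inner solver. Conjugate gradient is optimal in the energy norm over the Krylov space, and a shifted
Chebyshev polynomial bounds that optimum. After 4√κ(1 + log κ) iterations the error is at most a
tenth of the norm of the solution (`norm_cg_sub_le`). The factor log κ pays for passing from the
energy norm to the Euclidean norm. Hence the errors of y and u contract, up to the drift of `yStar`
and `uStar` caused by moving x (`norm_nboStep_y_le`, `norm_nboStep_u_le`).

Smoothness of Φ. The increment of Φ differs from its linear part, given by `hypergradient`, by at
most 3L₁κ²‖h‖² (`abs_Phi_taylor_le`). The function `yStar` is never differentiated: its optimality
condition at two points, tested against `uStar`, replaces the implicit function theorem. This yields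
both the gradient of Φ and the descent inequality.

Step size. All bounds on d, on the box radii and on L₁ are powers of κ times constants. With α of
order κ⁻³ the box of admissible points is invariant (`nboStep_mem_box`), and a weighted error e
satisfies e⁺ ≤ (4/5)e + (1/10)‖d‖ (`weightedError_nboStep_le`).

Potential. Φ + (5/2)αe² drops by at least (α/2)‖∇Φ‖² per step, and telescoping gives the rate
(`exists_norm_sq_le_of_lyapunov`).

Complexity follows by counting oracle calls per step. Linear convergence of gradient descent from an
error polynomial in κ reaches the box in O(κ(1 + log κ)) steps (`exists_initBox_mem_box`). -/

open Set

noncomputable section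

namespace Bilevel

/-! ### Self-adjoint operators -/

section Operators

variable {V : Type*} [NormedAddCommGroup V] [InnerProductSpace ℝ V]

/-- A polynomial in a symmetric operator is bounded by its values on an interval that contains
the spectrum. -/
theorem norm_aeval_le [FiniteDimensional ℝ V] {H : V →ₗ[ℝ] V} (hs : H.IsSymmetric) {μ M ε : ℝ}
    (hμ : ∀ v, μ * ‖v‖ ^ 2 ≤ inner ℝ (H v) v) (hM : ∀ v, inner ℝ (H v) v ≤ M * ‖v‖ ^ 2)
    (p : Polynomial ℝ) (hp : ∀ t ∈ Icc μ M, |p.eval t| ≤ ε) (x : V) :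
    ‖Polynomial.aeval H p x‖ ≤ ε * ‖x‖ := by
  rcases eq_or_ne x 0 with rfl | hx
  · simp
  -- In an eigenbasis p(H) multiplies each coordinate by p(λ), and the two bounds on the quadratic
  -- form place every eigenvalue λ in [μ, M].
  let b := hs.eigenvectorBasis (n := Module.finrank ℝ V) rfl
  let l := hs.eigenvalues (n := Module.finrank ℝ V) rfl
  have hl : ∀ i, l i ∈ Icc μ M := by
    intro i
    have h1 : inner ℝ (H (b i)) (b i) = l i := by
      have : H (b i) = l i • b i := hs.apply_eigenvectorBasis rfl i
      rw [this, inner_smul_left, real_inner_self_eq_norm_sq, b.norm_eq_one]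
      simp
    have h2 := hμ (b i)
    have h3 := hM (b i)
    rw [h1, b.norm_eq_one] at h2 h3
    constructor <;> linarith
  have hcoef : ∀ i, inner ℝ (b i) (Polynomial.aeval H p x) = p.eval (l i) * inner ℝ (b i) x := by
    intro i
    have hH : ∀ v, inner ℝ (b i) (H v) = l i * inner ℝ (b i) v := by
      intro v
      have : H (b i) = l i • b i := hs.apply_eigenvectorBasis rfl i
      rw [← hs, this, inner_smul_left]
      simp
    clear hp
    induction p using Polynomial.induction_on' with
    | add p q hp hq => simp [inner_add_right, hp, hq, add_mul]
    | monomial k c =>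
      have hk : ∀ k : ℕ, inner ℝ (b i) ((H ^ k) x) = l i ^ k * inner ℝ (b i) x := by
        intro k
        induction k with
        | zero => simp
        | succ k ih => rw [pow_succ', Module.End.mul_apply, hH, ih]; ring
      simp [Polynomial.aeval_monomial, Module.algebraMap_end_apply, inner_smul_right, hk, mul_assoc]
  have hε : 0 ≤ ε := by
    have : Nontrivial V := ⟨x, 0, hx⟩
    have hpos : 0 < Module.finrank ℝ V := Module.finrank_pos
    exact (abs_nonneg _).trans (hp _ (hl ⟨0, hpos⟩))
  refine le_of_sq_le_sq ?_ (by positivity)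
  rw [mul_pow, ← b.sum_sq_norm_inner_right, ← b.sum_sq_norm_inner_right x, Finset.mul_sum]
  refine Finset.sum_le_sum fun i _ => ?_
  rw [hcoef, norm_mul, mul_pow]
  gcongr
  exact hp _ (hl i)

/-- A coercive operator on a finite-dimensional space is invertible. -/
theorem isInvertible_of_coercive [FiniteDimensional ℝ V] {H : V →L[ℝ] V} {μ : ℝ} (hμ0 : 0 < μ)
    (hμ : ∀ v, μ * ‖v‖ ^ 2 ≤ inner ℝ (H v) v) : H.IsInvertible := by
  have hinj : Function.Injective H.toLinearMap := by
    rw [← LinearMap.ker_eq_bot, LinearMap.ker_eq_bot']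
    intro v hv
    have h1 := hμ v
    have h2 : H v = 0 := hv
    rw [h2, inner_zero_left] at h1
    have : ‖v‖ ^ 2 ≤ 0 := by nlinarith
    simpa using this
  refine ⟨(LinearEquiv.ofInjectiveEndo H.toLinearMap hinj).toContinuousLinearEquiv, ?_⟩
  ext v
  rfl

theorem norm_le_of_coercive {H : V →L[ℝ] V} {μ : ℝ}
    (hμ : ∀ v, μ * ‖v‖ ^ 2 ≤ inner ℝ (H v) v) (v : V) : μ * ‖v‖ ≤ ‖H v‖ := by
  rcases eq_or_ne v 0 with rfl | hv
  · simp
  have h1 := hμ v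
  have h2 := real_inner_le_norm (H v) v
  have h3 : 0 < ‖v‖ := norm_pos_iff.2 hv
  nlinarith

end Operators

/-- A polynomial of degree at most `N` with value `1` at `0` that is small on `[M/κ, M]`. -/
theorem exists_chebyshev_bound {μ M κ : ℝ} (hμ : 0 < μ) (hκ : 1 ≤ κ) (hM : M ≤ κ * μ) (N : ℕ) :
    ∃ p : Polynomial ℝ, p.natDegree ≤ N ∧ p.eval 0 = 1 ∧
      ∀ t ∈ Icc μ M, |p.eval t| ≤ 2 * Real.exp (-(N / √κ)) := by
  -- The polynomial is T_N(cosh θ - Bt) / cosh(Nθ). The affine map sends 0 to cosh θ, where T_N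
  -- equals cosh(Nθ), sends μ to 1, and stays nonnegative up to M, so [μ, M] lands where |T_N| ≤ 1.
  set θ : ℝ := 1 / √κ with hθ
  have hsq : 1 ≤ √κ := by rw [Real.one_le_sqrt]; exact hκ
  have hκ0 : 0 < κ := by linarith
  have hθ2 : θ ^ 2 = 1 / κ := by rw [hθ, div_pow, Real.sq_sqrt hκ0.le]; simp
  have hc1 : 1 ≤ Real.cosh θ := Real.one_le_cosh θ
  have hc2 : Real.cosh θ - 1 ≤ 1 / κ := by
    have h1 := Real.cosh_le_exp_half_sq θ
    have hk1 : 1 / κ ≤ 1 := by rw [div_le_one hκ0]; exact hκ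
    have hk0 : 0 ≤ 1 / κ := by positivity
    rw [hθ2] at h1
    -- The exponential of 1/(2κ) exceeds 1 by at most 1/(2κ) + 1/(4κ²) ≤ 1/κ.
    have h2 := Real.abs_exp_sub_one_sub_id_le (x := 1 / κ / 2) (by rw [abs_of_nonneg (by linarith)]; linarith)
    have h3 := (abs_le.1 h2).2
    nlinarith
  set B : ℝ := (Real.cosh θ - 1) / μ with hB
  have hB0 : 0 ≤ B := by rw [hB]; exact div_nonneg (by linarith) hμ.le
  have hBμ : B * μ = Real.cosh θ - 1 := by rw [hB]; field_simp
  have hBM : B * M ≤ 1 := by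
    calc B * M ≤ B * (κ * μ) := by gcongr
      _ = (Real.cosh θ - 1) * κ := by rw [← hBμ]; ring
      _ ≤ 1 / κ * κ := by gcongr
      _ = 1 := by field_simp
  let q : Polynomial ℝ := Polynomial.C (Real.cosh θ) - Polynomial.C B * Polynomial.X
  have hq : q.natDegree ≤ 1 := by
    refine (Polynomial.natDegree_sub_le _ _).trans (max_le (by simp) ?_)
    exact (Polynomial.natDegree_C_mul_le _ _).trans Polynomial.natDegree_X_le
  refine ⟨Polynomial.C (1 / Real.cosh (N * θ)) * (Polynomial.Chebyshev.T ℝ N).comp q, ?_, ?_, ?_⟩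
  · refine (Polynomial.natDegree_C_mul_le _ _).trans ?_
    refine Polynomial.natDegree_comp_le.trans ?_
    rw [Polynomial.Chebyshev.natDegree_T]
    simpa using Nat.mul_le_mul_left N hq
  · have : q.eval 0 = Real.cosh θ := by simp [q]
    rw [Polynomial.eval_mul, Polynomial.eval_comp, this]
    have h := Polynomial.Chebyshev.T_real_cosh θ N
    push_cast at h
    rw [h, Polynomial.eval_C]
    field_simp [(Real.cosh_pos (N * θ)).ne']
  · rintro t ⟨ht1, ht2⟩
    rw [Polynomial.eval_mul, Polynomial.eval_comp, Polynomial.eval_C, abs_mul]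
    have hqe : q.eval t = Real.cosh θ - B * t := by simp [q]
    have hq1 : |q.eval t| ≤ 1 := by
      rw [hqe, abs_le]
      constructor
      · nlinarith
      · nlinarith
    have h1 := Polynomial.Chebyshev.abs_eval_T_real_le_one N hq1
    have h2 : Real.exp (N * θ) / 2 ≤ Real.cosh (N * θ) := by
      rw [Real.cosh_eq]
      have := Real.exp_pos (-(N * θ))
      linarith
    have h3 : |1 / Real.cosh (N * θ)| ≤ 2 * Real.exp (-(N / √κ)) := by
      rw [abs_of_nonneg (by positivity), Real.exp_neg, div_le_iff₀ (Real.cosh_pos _)]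
      have : (N : ℝ) / √κ = N * θ := by rw [hθ]; ring
      rw [this]
      have h4 := Real.exp_pos (N * θ)
      calc (1 : ℝ) = 2 * (Real.exp (N * θ))⁻¹ * (Real.exp (N * θ) / 2) := by field_simp
        _ ≤ _ := by gcongr
    calc _ ≤ |1 / Real.cosh (N * θ)| * 1 := by gcongr
      _ ≤ _ := by simpa using h3

/-! ### Conjugate gradient -/

@[simp] theorem bind_val {A B : Type} (c : Counted A) (k : A → Counted B) :
    (c >>= k).val = (k c.val).val := rfl

@[simp] theorem pure_val {A : Type} (x : A) : (pure x : Counted A).val = x := rfl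

section CG

variable {n : ℕ} {H : Vec n →L[ℝ] Vec n} {O : Vec n → Counted (Vec n)}

theorem cgStep_val_of_res_eq_zero {s : CGState n} (h : s.res = 0) : (cgStep O s).val = s := by
  rw [cgStep, if_pos h, pure_val]

/-- The state of conjugate gradient after `N` iterations for `H v = b`, where `W` is the span of
the previous search directions. -/
structure CGInvariant (H : Vec n →L[ℝ] Vec n) (b : Vec n) (N : ℕ) (s : CGState n)
    (W : Submodule ℝ (Vec n)) : Prop where
  sol_mem : s.sol ∈ W
  res_orthogonal : ∀ z ∈ W, inner ℝ s.res z = 0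
  dir_conjugate : ∀ z ∈ W, inner ℝ s.dir (H z) = 0
  dir_sub_res_mem : s.dir - s.res ∈ W
  map_mem : ∀ z ∈ W, H z ∈ W ⊔ Submodule.span ℝ {s.dir}
  rhs_mem : b ∈ W ⊔ Submodule.span ℝ {s.dir}
  krylov : ∀ q : Polynomial ℝ, q.natDegree < N → Polynomial.aeval H.toLinearMap q b ∈ W

/-- This excludes breakdown: as long as the residual is nonzero, so is the search direction. -/
theorem CGInvariant.inner_dir_res {b : Vec n} {N : ℕ} {s : CGState n}
    {W : Submodule ℝ (Vec n)} (h : CGInvariant H b N s W) :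
    inner ℝ s.res s.dir = ‖s.res‖ ^ 2 := by
  have h1 := h.res_orthogonal _ h.dir_sub_res_mem
  rw [inner_sub_right, real_inner_self_eq_norm_sq] at h1
  linarith

/-- The new residual is orthogonal to W because `dir` is conjugate to W, and to `dir` by the choice
of the step length. Since H maps W into W + span `dir`, it is then automatically conjugate to W, so
correcting it along `dir` alone makes the new direction conjugate to everything before. -/
theorem CGInvariant.step (hs : H.toLinearMap.IsSymmetric) {μ : ℝ} (hμ0 : 0 < μ)
    (hμ : ∀ v, μ * ‖v‖ ^ 2 ≤ inner ℝ (H v) v) (hO : ∀ v, (O v).val = H v)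
    {b : Vec n} {N : ℕ} {s : CGState n} {W : Submodule ℝ (Vec n)} (h : CGInvariant H b N s W)
    (hr : s.res ≠ 0) :
    CGInvariant H b (N + 1) (cgStep O s).val (W ⊔ Submodule.span ℝ {s.dir}) ∧
      (s.res = b - H s.sol → (cgStep O s).val.res = b - H (cgStep O s).val.sol) := by
  have hsym : ∀ x y, inner ℝ (H x) y = inner ℝ x (H y) := fun x y => hs x y
  have hrn : 0 < ‖s.res‖ := norm_pos_iff.2 hr
  have hpr := h.inner_dir_res
  have hp : s.dir ≠ 0 := by
    rintro hp
    rw [hp, inner_zero_right] at hpr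
    nlinarith
  have hpn : 0 < ‖s.dir‖ := norm_pos_iff.2 hp
  set c : ℝ := inner ℝ s.dir (H s.dir) with hc
  have hc0 : 0 < c := by
    have h1 := hμ s.dir
    rw [hsym] at h1
    exact lt_of_lt_of_le (by positivity) h1
  set a : ℝ := ‖s.res‖ ^ 2 / c with ha
  have ha0 : 0 < a := by positivity
  set r : Vec n := s.res - a • H s.dir with hrdef
  set e : ℝ := ‖r‖ ^ 2 / ‖s.res‖ ^ 2 with he
  have hstep : (cgStep O s).val = ⟨s.sol + a • s.dir, r, r + e • s.dir⟩ := by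
    rw [cgStep, if_neg hr]
    simp only [bind_val, pure_val, hO]
    rfl
  set W' := W ⊔ Submodule.span ℝ {s.dir} with hW'
  have hWW : W ≤ W' := le_sup_left
  have hdW : s.dir ∈ W' := Submodule.mem_sup_right (Submodule.mem_span_singleton_self _)
  have hrW : s.res ∈ W' := by
    have := W'.sub_mem hdW (hWW h.dir_sub_res_mem)
    simpa using this
  have hind : ∀ {P : Vec n → Prop}, (∀ w ∈ W, ∀ t : ℝ, P (w + t • s.dir)) → ∀ z ∈ W', P z := by
    intro P hP z hz
    obtain ⟨w, hw, y, hy, rfl⟩ := Submodule.mem_sup.1 hz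
    obtain ⟨t, rfl⟩ := Submodule.mem_span_singleton.1 hy
    exact hP w hw t
  have hrorth : ∀ z ∈ W', inner ℝ r z = 0 := by
    refine hind fun w hw t => ?_
    have h1 : inner ℝ (H s.dir) w = 0 := by rw [hsym]; exact h.dir_conjugate w hw
    have h2 : inner ℝ (H s.dir) s.dir = c := by rw [hsym]
    rw [hrdef, inner_add_right, inner_sub_left, inner_sub_left, inner_smul_right, inner_smul_right,
      inner_smul_left, inner_smul_left, h.res_orthogonal w hw, h1, hpr, h2]
    simp only [ha, RCLike.conj_to_real]
    field_simp
    ring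
  have hHd : a • H s.dir = s.res - r := by rw [hrdef]; abel
  have hrr : inner ℝ r (H s.dir) = - (‖r‖ ^ 2 / a) := by
    have h1 : a * inner ℝ r (H s.dir) = - ‖r‖ ^ 2 := by
      rw [← real_inner_smul_right, hHd, inner_sub_right, hrorth _ hrW,
        real_inner_self_eq_norm_sq]
      ring
    field_simp
    linarith
  have hnew : r ∈ W' ⊔ Submodule.span ℝ {r + e • s.dir} := by
    have h1 := Submodule.sub_mem (W' ⊔ Submodule.span ℝ {r + e • s.dir})
      (Submodule.mem_sup_right (Submodule.mem_span_singleton_self _))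
      (Submodule.mem_sup_left (W'.smul_mem e hdW))
    rwa [add_sub_cancel_right] at h1
  -- The residual recurrence writes H `dir` as a multiple of the difference of two residuals, and
  -- both lie in the enlarged space.
  have hHdW : H s.dir ∈ W' ⊔ Submodule.span ℝ {r + e • s.dir} := by
    have h1 : H s.dir = a⁻¹ • (s.res - r) := by rw [← hHd, smul_smul, inv_mul_cancel₀ ha0.ne', one_smul]
    rw [h1]
    exact Submodule.smul_mem _ _ (Submodule.sub_mem _ (Submodule.mem_sup_left hrW) hnew)
  rw [hstep]
  refine ⟨⟨?_, hrorth, ?_, ?_, ?_, ?_, ?_⟩, ?_⟩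
  · exact W'.add_mem (hWW h.sol_mem) (W'.smul_mem _ hdW)
  · refine hind fun w hw t => ?_
    have h1 : inner ℝ r (H w) = 0 := hrorth _ (h.map_mem w hw)
    simp only [map_add, map_smul, inner_add_right, inner_add_left, inner_smul_left,
      inner_smul_right, h1, h.dir_conjugate w hw, hrr, RCLike.conj_to_real, ← hc, he, ha]
    field_simp
    ring
  · have : r + e • s.dir - r = e • s.dir := by abel
    simp only [this]
    exact W'.smul_mem _ hdW
  · refine hind fun w hw t => ?_
    rw [map_add, map_smul]
    exact Submodule.add_mem _ (Submodule.mem_sup_left (h.map_mem w hw))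
      (Submodule.smul_mem _ _ hHdW)
  · exact Submodule.mem_sup_left h.rhs_mem
  · intro q hq
    rcases Nat.eq_zero_or_pos q.natDegree with h0 | h0
    · rw [Polynomial.eq_C_of_natDegree_eq_zero h0]
      simpa [Module.algebraMap_end_apply] using W'.smul_mem _ h.rhs_mem
    -- Splitting q = X · `divX` q + q(0) reduces q(H)b to the image under H of an element of W plus
    -- a multiple of b.
    · have h1 : q.divX.natDegree < N := by
        rw [Polynomial.natDegree_divX_eq_natDegree_tsub_one]; omega
      have h2 := W'.add_mem (h.map_mem _ (h.krylov _ h1)) (W'.smul_mem (q.coeff 0) h.rhs_mem)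
      convert h2 using 1
      conv_lhs => rw [← Polynomial.divX_mul_X_add q, mul_comm]
      rw [map_add, map_mul, Polynomial.aeval_X, Polynomial.aeval_C]
      rfl
  · intro h1
    simp only [hrdef, map_add, map_smul, h1]
    abel

/-- A vanishing residual freezes the state while N still grows, hence the alternative. In that case
the residual formula says that the solution is exact. -/
theorem cgIter_invariant (hs : H.toLinearMap.IsSymmetric) {μ : ℝ} (hμ0 : 0 < μ)
    (hμ : ∀ v, μ * ‖v‖ ^ 2 ≤ inner ℝ (H v) v) (hO : ∀ v, (O v).val = H v) (b : Vec n) (N : ℕ) :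
    (cgIter O ⟨0, b, b⟩ N).val.res = b - H (cgIter O ⟨0, b, b⟩ N).val.sol ∧
      ((cgIter O ⟨0, b, b⟩ N).val.res = 0 ∨
        ∃ W, CGInvariant H b N (cgIter O ⟨0, b, b⟩ N).val W) := by
  induction N with
  | zero =>
    refine ⟨by simp [cgIter], Or.inr ⟨⊥, ?_⟩⟩
    constructor <;> simp [cgIter, Submodule.mem_span_singleton_self]
  | succ N ih =>
    have hval : (cgIter O ⟨0, b, b⟩ (N + 1)).val = (cgStep O (cgIter O ⟨0, b, b⟩ N).val).val := rfl
    rw [hval]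
    obtain ⟨h1, h2⟩ := ih
    by_cases hr : (cgIter O ⟨0, b, b⟩ N).val.res = 0
    · rw [cgStep_val_of_res_eq_zero hr]
      exact ⟨h1, Or.inl hr⟩
    · obtain ⟨W, hW⟩ := h2.resolve_left hr
      obtain ⟨h3, h4⟩ := hW.step hs hμ0 hμ hO hr
      exact ⟨h4 h1, Or.inr ⟨_, h3⟩⟩

/-- Conjugate gradient minimizes the energy norm of the error over the Krylov space. -/
theorem cgIter_energy_le (hs : H.toLinearMap.IsSymmetric) {μ : ℝ} (hμ0 : 0 < μ)
    (hμ : ∀ v, μ * ‖v‖ ^ 2 ≤ inner ℝ (H v) v) (hO : ∀ v, (O v).val = H v) {b x : Vec n}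
    (hx : H x = b) (N : ℕ) (p : Polynomial ℝ) (hp : p.natDegree ≤ N) (hp0 : p.eval 0 = 1) :
    let e := x - (cgIter O ⟨0, b, b⟩ N).val.sol
    let d := Polynomial.aeval H.toLinearMap p x
    inner ℝ (H e) e ≤ inner ℝ (H d) d := by
  intro e d
  have hpos : ∀ v, 0 ≤ inner ℝ (H v) v := fun v => le_trans (by positivity) (hμ v)
  obtain ⟨h1, h2⟩ := cgIter_invariant hs hμ0 hμ hO b N
  have hHe : H e = (cgIter O ⟨0, b, b⟩ N).val.res := by rw [h1, map_sub, hx]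
  rcases h2 with h2 | ⟨W, hW⟩
  · rw [hHe, h2, inner_zero_left]
    exact hpos d
  · have hd : d - e ∈ W := by
      -- For N = 0 the Krylov clause is empty, but p = 1 forces d = e. Otherwise p(0) = 1 makes x -
      -- p(H)x a polynomial of degree below N in H applied to b.
      rcases Nat.eq_zero_or_pos N with h0 | h0
      · subst h0
        have hp1 : p = 1 := by
          rw [Polynomial.eq_C_of_natDegree_le_zero hp] at hp0 ⊢
          simp only [Polynomial.eval_C] at hp0
          simp [hp0]
        simp [d, e, hp1, cgIter]
      · have hdx : x - d ∈ W := by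
          have h3 : p.coeff 0 = 1 := by rw [Polynomial.coeff_zero_eq_eval_zero, hp0]
          have h4 := hW.krylov (-p.divX) (by
            rw [Polynomial.natDegree_neg, Polynomial.natDegree_divX_eq_natDegree_tsub_one]; omega)
          convert h4 using 1
          simp only [d]
          conv_lhs => rw [← Polynomial.divX_mul_X_add p, h3]
          simp [hx]
        have h5 := W.sub_mem hW.sol_mem hdx
        convert h5 using 1
        simp only [e]
        abel
    -- Galerkin orthogonality: H e is the residual and d - e lies in W. The conclusion is Pythagoras
    -- in the energy inner product.
    have h3 : inner ℝ (H e) (d - e) = 0 := by rw [hHe]; exact hW.res_orthogonal _ hd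
    have h4 : inner ℝ (H (d - e)) e = 0 := by
      rw [show inner ℝ (H (d - e)) e = inner ℝ (d - e) (H e) from hs _ _, real_inner_comm]
      exact h3
    have h5 : inner ℝ (H d) d = inner ℝ (H e) e + inner ℝ (H (d - e)) (d - e) := by
      have : d = e + (d - e) := by abel
      conv_lhs => rw [this]
      rw [map_add, inner_add_left, inner_add_right, inner_add_right, h3, h4]
      ring
    have := hpos (d - e)
    linarith

/-- Linear convergence of conjugate gradient. -/
theorem norm_cg_sub_le (hs : H.toLinearMap.IsSymmetric) {μ M κ : ℝ} (hμ0 : 0 < μ)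
    (hμ : ∀ v, μ * ‖v‖ ^ 2 ≤ inner ℝ (H v) v) (hM : ∀ v, inner ℝ (H v) v ≤ M * ‖v‖ ^ 2)
    (hκ : 1 ≤ κ) (hMκ : M ≤ κ * μ) (hO : ∀ v, (O v).val = H v) {b x : Vec n}
    (hx : H x = b) (T : ℕ) (hT : 4 * (√κ * (1 + Real.log κ)) ≤ T) :
    ‖(cg O b T).val - x‖ ≤ 1 / 10 * ‖x‖ := by
  obtain ⟨p, hp1, hp2, hp3⟩ := exists_chebyshev_bound hμ0 hκ hMκ (T + 1)
  have hen := cgIter_energy_le hs hμ0 hμ hO hx (T + 1) p hp1 hp2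
  set ε : ℝ := 2 * Real.exp (-(((T + 1 : ℕ) : ℝ) / √κ)) with hε
  have hval : (cg O b T).val = (cgIter O ⟨0, b, b⟩ (T + 1)).val.sol := rfl
  rw [hval, norm_sub_rev]
  set e := x - (cgIter O ⟨0, b, b⟩ (T + 1)).val.sol
  set d := Polynomial.aeval H.toLinearMap p x
  have hd : ‖d‖ ≤ ε * ‖x‖ := norm_aeval_le hs hμ hM p hp3 x
  have hκ0 : 0 < κ := by linarith
  have hsq : 0 < √κ := Real.sqrt_pos.2 hκ0
  have hεκ : √κ * ε ≤ 1 / 10 := by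
    have hl : 0 ≤ Real.log κ := Real.log_nonneg hκ
    have h1 : 4 + Real.log κ ≤ ((T + 1 : ℕ) : ℝ) / √κ := by
      rw [le_div_iff₀ hsq]
      push_cast
      nlinarith
    have h2 : Real.exp (-(((T + 1 : ℕ) : ℝ) / √κ)) ≤ Real.exp (-4) * κ⁻¹ := by
      rw [← Real.exp_log (inv_pos.2 hκ0), ← Real.exp_add, Real.log_inv]
      exact Real.exp_le_exp.2 (by linarith)
    have h3 : √κ * κ⁻¹ ≤ 1 := by
      rw [← div_eq_mul_inv, div_le_one hκ0]
      exact Real.sqrt_le_iff.2 ⟨hκ0.le, by nlinarith⟩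
    have h4 : Real.exp (-4) ≤ 1 / 20 := by
      have h5 := Real.exp_one_gt_d9
      have h6 : Real.exp (-4) = (Real.exp 1 ^ 4)⁻¹ := by
        rw [Real.exp_neg, ← Real.exp_nat_mul]; norm_num
      have h7 : (20 : ℝ) ≤ Real.exp 1 ^ 4 := by
        calc (20 : ℝ) ≤ 2.7 ^ 4 := by norm_num
          _ ≤ _ := by gcongr; linarith
      rw [h6, one_div]
      exact inv_anti₀ (by norm_num) h7
    have h5 := Real.exp_pos (-4)
    calc √κ * ε ≤ √κ * (2 * (Real.exp (-4) * κ⁻¹)) := by rw [hε]; gcongr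
      _ = 2 * Real.exp (-4) * (√κ * κ⁻¹) := by ring
      _ ≤ 2 * (1 / 20) * 1 := by gcongr
      _ = _ := by norm_num
  have h1 : ‖e‖ ^ 2 ≤ (√κ * ‖d‖) ^ 2 := by
    rw [mul_pow, Real.sq_sqrt hκ0.le]
    have h2 := hμ e
    have h3 := hM d
    have h4 : M * ‖d‖ ^ 2 ≤ κ * μ * ‖d‖ ^ 2 := by gcongr
    have h5 : μ * ‖e‖ ^ 2 ≤ μ * (κ * ‖d‖ ^ 2) := by linarith
    exact le_of_mul_le_mul_left h5 hμ0
  have h2 : ‖e‖ ≤ √κ * ‖d‖ := le_of_sq_le_sq h1 (by positivity)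
  calc ‖e‖ ≤ √κ * ‖d‖ := h2
    _ ≤ √κ * (ε * ‖x‖) := by gcongr
    _ = √κ * ε * ‖x‖ := by ring
    _ ≤ _ := by gcongr

end CG

/-! ### Calculus -/

section Calculus

variable {E F : Type*} [NormedAddCommGroup E] [NormedSpace ℝ E]
  [NormedAddCommGroup F] [NormedSpace ℝ F]

/-- Comparison with the primitive At + Ct²/2. The linear growth of the derivative bound produces the
factor 1/2 in the Taylor estimates below. -/
theorem norm_image_one_sub_le {γ γ' : ℝ → F} {A C : ℝ} (h : ∀ t, HasDerivAt γ (γ' t) t)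
    (hb : ∀ t, 0 ≤ t → ‖γ' t‖ ≤ A + C * t) : ‖γ 1 - γ 0‖ ≤ A + C / 2 := by
  have key := image_norm_le_of_norm_deriv_right_le_deriv_boundary (a := 0) (b := 1)
    (f := fun t => γ t - γ 0) (f' := γ') (B := fun t => A * t + C / 2 * t ^ 2) (B' := fun t => A + C * t)
    (fun t _ => ((h t).sub_const _).continuousAt.continuousWithinAt)
    (fun t _ => ((h t).sub_const _).hasDerivWithinAt)
    (by simp)
    (fun t => by
      refine (((hasDerivAt_id t).const_mul A).add
        ((hasDerivAt_pow 2 t).const_mul (C / 2))).congr_deriv ?_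
      simp only [Nat.add_one_sub_one, pow_one]
      push_cast
      ring)
    (fun t ht => hb t ht.1)
    (x := 1) (by simp)
  simpa using key

theorem norm_taylor_le {f : E → F} {f' : E → E →L[ℝ] F} {L : ℝ}
    (hf : ∀ y, HasFDerivAt f (f' y) y) (hL : ∀ y z, ‖f' y - f' z‖ ≤ L * ‖y - z‖) (y k : E) :
    ‖f (y + k) - f y - f' y k‖ ≤ L / 2 * ‖k‖ ^ 2 := by
  have hγ : ∀ t : ℝ, HasDerivAt (fun t : ℝ => f (y + t • k) - t • f' y k)
      (f' (y + t • k) k - f' y k) t := by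
    intro t
    have h1 : HasDerivAt (fun t : ℝ => y + t • k) k t := by
      simpa using ((hasDerivAt_id t).smul_const k).const_add y
    have h2 := (hf (y + t • k)).comp_hasDerivAt t h1
    have h3 : HasDerivAt (fun t : ℝ => t • f' y k) (f' y k) t := by
      simpa using (hasDerivAt_id t).smul_const (f' y k)
    exact h2.sub h3
  have := norm_image_one_sub_le (A := 0) (C := L * ‖k‖ ^ 2) hγ (fun t ht => by
    have h1 : ‖f' (y + t • k) - f' y‖ ≤ L * (t * ‖k‖) := by
      have := hL (y + t • k) y
      rwa [add_sub_cancel_left, norm_smul, Real.norm_of_nonneg ht] at this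
    calc ‖f' (y + t • k) k - f' y k‖ = ‖(f' (y + t • k) - f' y) k‖ := rfl
      _ ≤ ‖f' (y + t • k) - f' y‖ * ‖k‖ := ContinuousLinearMap.le_opNorm _ _
      _ ≤ L * (t * ‖k‖) * ‖k‖ := by gcongr
      _ = _ := by ring)
  rw [zero_add] at this
  convert this using 1
  · simp only [one_smul, zero_smul, add_zero, sub_zero]
    congr 1
    abel
  · ring

end Calculus

/-! ### Smooth and strongly convex functions. -/

section Gradient

variable {E : Type*} [NormedAddCommGroup E] [InnerProductSpace ℝ E] [CompleteSpace E]

/-- The descent lemma. -/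
theorem abs_taylor_gradient_le {h : E → ℝ} {h' : E → E} {L : ℝ}
    (hh : ∀ y, HasGradientAt h (h' y) y) (hL : ∀ y z, ‖h' y - h' z‖ ≤ L * ‖y - z‖) (y k : E) :
    |h (y + k) - h y - inner ℝ (h' y) k| ≤ L / 2 * ‖k‖ ^ 2 := by
  have := norm_taylor_le (f' := fun y => InnerProductSpace.toDual ℝ E (h' y))
    (fun y => (hh y).hasFDerivAt) (fun y z => by
      rw [← map_sub, LinearIsometryEquiv.norm_map]; exact hL y z) y k
  simpa using this

theorem _root_.HasGradientAt.hasDerivAt_line {h : E → ℝ} {y v : E} (t : ℝ) (k : E)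
    (hh : HasGradientAt h v (y + t • k)) :
    HasDerivAt (fun t : ℝ => h (y + t • k)) (inner ℝ v k) t := by
  have h1 : HasDerivAt (fun t : ℝ => y + t • k) k t := by
    simpa using ((hasDerivAt_id t).smul_const k).const_add y
  have h2 := hh.hasFDerivAt.comp_hasDerivAt t h1
  rwa [InnerProductSpace.toDual_apply_apply] at h2

/-- The first-order characterization of strong convexity. -/
theorem strongConvexOn_lower_bound {h : E → ℝ} {μ : ℝ} (hc : StrongConvexOn univ μ h) {y v : E}
    (hv : HasGradientAt h v y) (z : E) :
    h y + inner ℝ v (z - y) + μ / 2 * ‖z - y‖ ^ 2 ≤ h z := by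
  have hd : HasDerivAt (fun t : ℝ => h (y + t • (z - y))) (inner ℝ v (z - y)) 0 :=
    HasGradientAt.hasDerivAt_line 0 (z - y) (by simpa using hv)
  have hlim := hd.tendsto_slope_zero_right
  have hlim2 : Filter.Tendsto (fun t : ℝ => h z - h y - (1 - t) * (μ / 2 * ‖z - y‖ ^ 2))
      (nhdsWithin 0 (Ioi 0)) (nhds (h z - h y - (1 - 0) * (μ / 2 * ‖z - y‖ ^ 2))) := by
    refine Filter.Tendsto.mono_left (Continuous.tendsto (by fun_prop) 0) nhdsWithin_le_nhds
  have hle := le_of_tendsto_of_tendsto hlim hlim2 (by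
    -- Strong convexity on the segment from y to z, divided by t, bounds the difference quotient at
    -- y; the limit t → 0 removes the factor 1 - t.
    filter_upwards [Ioo_mem_nhdsGT (zero_lt_one' ℝ)] with t ⟨ht0, ht1⟩
    have h1 := hc.2 (mem_univ y) (mem_univ z) (by linarith : 0 ≤ 1 - t) ht0.le
      (by ring)
    have h2 : (1 - t) • y + t • z = y + t • (z - y) := by
      rw [sub_smul, smul_sub, one_smul]; abel
    rw [h2, norm_sub_rev y z] at h1
    simp only [smul_eq_mul] at h1
    simp only [zero_add, zero_smul, add_zero, smul_eq_mul]
    rw [inv_mul_le_iff₀ ht0]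
    nlinarith)
  linarith

theorem strongConvexOn_inner_gradient {h : E → ℝ} {μ : ℝ} (hc : StrongConvexOn univ μ h)
    {y z v w : E} (hv : HasGradientAt h v y) (hw : HasGradientAt h w z) :
    μ * ‖y - z‖ ^ 2 ≤ inner ℝ (v - w) (y - z) := by
  have h1 := strongConvexOn_lower_bound hc hv z
  have h2 := strongConvexOn_lower_bound hc hw y
  rw [norm_sub_rev] at h1
  rw [← neg_sub y z, inner_neg_right] at h1
  rw [inner_sub_left]
  linarith

theorem gradient_eq_zero_of_forall_le {h : E → ℝ} {y v : E} (hv : HasGradientAt h v y)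
    (hmin : ∀ z, h y ≤ h z) : v = 0 := by
  have h1 : IsLocalMin h y := Filter.Eventually.of_forall hmin
  have := h1.hasFDerivAt_eq_zero hv.hasFDerivAt
  simpa using this

/-- The quadratic lower bound at 0 tends to infinity with the norm, so a continuous function above
it attains its minimum. -/
theorem exists_forall_le_of_strongConvexOn [FiniteDimensional ℝ E] {h : E → ℝ} {μ : ℝ}
    (hμ : 0 < μ) (hc : StrongConvexOn univ μ h) (hd : Differentiable ℝ h) :
    ∃ y, ∀ z, h y ≤ h z := by
  refine hd.continuous.exists_forall_le ?_
  have hv := (hd 0).hasGradientAt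
  set v := gradient h 0
  have hquad : Filter.Tendsto (fun t : ℝ => t * (μ / 2 * t - ‖v‖) + h 0) Filter.atTop
      Filter.atTop := by
    refine Filter.tendsto_atTop_add_const_right _ _ ?_
    refine Filter.tendsto_id.atTop_mul_atTop₀ ?_
    refine Filter.tendsto_atTop_add_const_right _ _ ?_
    exact Filter.tendsto_id.const_mul_atTop (by positivity)
  refine Filter.tendsto_atTop_mono (fun z => ?_)
    (hquad.comp (tendsto_norm_cocompact_atTop (E := E)))
  have h1 := strongConvexOn_lower_bound hc hv z
  have h2 := (abs_le.1 (abs_real_inner_le_norm v (z - 0))).1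
  simp only [sub_zero, Function.comp] at h1 h2 ⊢
  nlinarith

/-- Symmetry of the second derivative, read through the Riesz identification. Differentiability of
the gradient at the one point suffices. -/
theorem isSymmetric_of_hasGradientAt {h : E → ℝ} {h' : E → E} {H : E →L[ℝ] E} {y : E}
    (hh : ∀ y, HasGradientAt h (h' y) y) (hH : HasFDerivAt h' H y) :
    H.toLinearMap.IsSymmetric := by
  let B : E →L[ℝ] E →L[ℝ] ℝ := (isBoundedBilinearMap_inner (𝕜 := ℝ) (E := E)).toContinuousLinearMap
  have h1 : ∀ y, HasFDerivAt h (B (h' y)) y := fun y => (hh y).hasFDerivAt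
  have h2 : HasFDerivAt (fun y => B (h' y)) (B.comp H) y := B.hasFDerivAt.comp y hH
  intro v w
  have := second_derivative_symmetric h1 h2 v w
  change inner ℝ (H v) w = inner ℝ v (H w)
  rw [real_inner_comm (H w) v]
  exact this

/-- The infinitesimal form of strong monotonicity of the gradient along y + tv. -/
theorem coercive_of_hasGradientAt {h : E → ℝ} {h' : E → E} {H : E →L[ℝ] E} {y : E} {μ : ℝ}
    (hc : StrongConvexOn univ μ h) (hh : ∀ y, HasGradientAt h (h' y) y) (hH : HasFDerivAt h' H y)
    (v : E) : μ * ‖v‖ ^ 2 ≤ inner ℝ (H v) v := by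
  have h1 : HasDerivAt (fun t : ℝ => y + t • v) v 0 := by
    simpa using ((hasDerivAt_id (0 : ℝ)).smul_const v).const_add y
  have h2 : HasDerivAt (fun t : ℝ => h' (y + t • v)) (H v) 0 := by
    refine HasFDerivAt.comp_hasDerivAt 0 ?_ h1
    simpa using hH
  have hlim := (h2.tendsto_slope_zero_right).inner (𝕜 := ℝ) (tendsto_const_nhds (x := v))
  refine ge_of_tendsto hlim ?_
  filter_upwards [self_mem_nhdsWithin] with t ht
  have ht0 : (0 : ℝ) < t := ht
  have h3 := strongConvexOn_inner_gradient hc (hh (y + t • v)) (hh y)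
  rw [add_sub_cancel_left, norm_smul, Real.norm_of_nonneg ht0.le, inner_smul_right] at h3
  simp only [zero_add, zero_smul, add_zero]
  rw [real_inner_smul_left, le_inv_mul_iff₀ ht0]
  refine le_of_mul_le_mul_left ?_ ht0
  calc _ = μ * (t * ‖v‖) ^ 2 := by ring
    _ ≤ _ := h3

/-- Gradient descent is a contraction for smooth strongly convex functions. -/
theorem gradient_step_contraction {h : E → ℝ} {h' : E → E} {μ L β : ℝ} (hL0 : 0 < L)
    (hc : StrongConvexOn univ μ h) (hh : ∀ y, HasGradientAt h (h' y) y)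
    (hL : ∀ y z, ‖h' y - h' z‖ ≤ L * ‖y - z‖) (hβ0 : 0 < β) (hβ : β ≤ 1 / L) {z : E}
    (hz : ∀ y, h z ≤ h y) (y : E) :
    ‖y - β • h' y - z‖ ^ 2 ≤ (1 - β * μ) * ‖y - z‖ ^ 2 := by
  -- An auxiliary step of length 1/L bounds h(z) above by h(y) - ‖h'(y)‖²/(2L), whatever β is.
  -- Together with strong convexity at y this controls the cross term of the expanded square; β ≤
  -- 1/L enters only through `h6`.
  have h1 := strongConvexOn_lower_bound hc (hh y) z
  have h2 := (abs_le.1 (abs_taylor_gradient_le hh hL y (-(1 / L) • h' y))).2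
  have h3 := hz (y + -(1 / L) • h' y)
  rw [inner_smul_right, real_inner_self_eq_norm_sq, norm_smul, mul_pow, Real.norm_eq_abs,
    sq_abs] at h2
  have h4 : L / 2 * ((-(1 / L)) ^ 2 * ‖h' y‖ ^ 2) = 1 / L * ‖h' y‖ ^ 2 / 2 := by
    field_simp
  rw [h4] at h2
  have h5 : ‖y - β • h' y - z‖ ^ 2
      = ‖y - z‖ ^ 2 + 2 * β * inner ℝ (h' y) (z - y) + β ^ 2 * ‖h' y‖ ^ 2 := by
    have : y - β • h' y - z = (y - z) - β • h' y := by abel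
    rw [this, norm_sub_sq_real, inner_smul_right, norm_smul, mul_pow, Real.norm_eq_abs, sq_abs,
      ← neg_sub y z, inner_neg_right, real_inner_comm]
    ring
  rw [h5]
  rw [norm_sub_rev z y] at h1
  have h6 : β * (β * ‖h' y‖ ^ 2) ≤ β * (1 / L * ‖h' y‖ ^ 2) := by gcongr
  have h7 : 2 * β * (inner ℝ (h' y) (z - y) + μ / 2 * ‖y - z‖ ^ 2 + 1 / L * ‖h' y‖ ^ 2 / 2) ≤ 0 := by
    have : inner ℝ (h' y) (z - y) + μ / 2 * ‖y - z‖ ^ 2 + 1 / L * ‖h' y‖ ^ 2 / 2 ≤ 0 := by linarith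
    nlinarith
  nlinarith

end Gradient

/-! ### The bilevel problem -/

section Points

variable {m n : ℕ}

theorem pt_sub (x x' : Vec m) (y y' : Vec n) : pt x y - pt x' y' = pt (x - x') (y - y') := rfl

theorem pt_add (x x' : Vec m) (y y' : Vec n) : pt x y + pt x' y' = pt (x + x') (y + y') := rfl

theorem norm_pt_sq (x : Vec m) (y : Vec n) : ‖pt x y‖ ^ 2 = ‖x‖ ^ 2 + ‖y‖ ^ 2 :=
  WithLp.prod_norm_sq_eq_of_L2 _

theorem norm_pt_zero_left (y : Vec n) : ‖pt (0 : Vec m) y‖ = ‖y‖ := by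
  rw [← sq_eq_sq₀ (norm_nonneg _) (norm_nonneg _), norm_pt_sq]; simp

theorem norm_pt_zero_right (x : Vec m) : ‖pt x (0 : Vec n)‖ = ‖x‖ := by
  rw [← sq_eq_sq₀ (norm_nonneg _) (norm_nonneg _), norm_pt_sq]; simp

theorem norm_pt_le (x : Vec m) (y : Vec n) : ‖pt x y‖ ≤ ‖x‖ + ‖y‖ := by
  refine le_of_sq_le_sq ?_ (by positivity)
  rw [norm_pt_sq]
  nlinarith [norm_nonneg x, norm_nonneg y]

theorem norm_fst_le (p : Joint m n) : ‖p.fst‖ ≤ ‖p‖ := by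
  refine le_of_sq_le_sq ?_ (by positivity)
  rw [WithLp.prod_norm_sq_eq_of_L2 p]
  nlinarith [norm_nonneg p.snd]

theorem norm_snd_le (p : Joint m n) : ‖p.snd‖ ≤ ‖p‖ := by
  refine le_of_sq_le_sq ?_ (by positivity)
  rw [WithLp.prod_norm_sq_eq_of_L2 p]
  nlinarith [norm_nonneg p.fst]

theorem inner_pt (p : Joint m n) (x : Vec m) (y : Vec n) :
    inner ℝ p (pt x y) = inner ℝ p.fst x + inner ℝ p.snd y :=
  WithLp.prod_inner_apply _ _

theorem hasGradientAt_left {h : Joint m n → ℝ} (hd : Differentiable ℝ h) (x : Vec m) (y : Vec n) :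
    HasGradientAt (fun x' => h (pt x' y)) (grad1 h x y) x := by
  let ι : Vec m →L[ℝ] Joint m n :=
    (WithLp.prodContinuousLinearEquiv 2 ℝ (Vec m) (Vec n)).symm.toContinuousLinearMap.comp
      (ContinuousLinearMap.inl ℝ _ _)
  have hι : HasFDerivAt (fun x' : Vec m => pt x' y) ι x := by
    have h1 := (ι.hasFDerivAt (x := x)).add_const (pt 0 y)
    have h2 : (fun x' => ι x' + pt 0 y) = fun x' : Vec m => pt x' y := by
      funext x'
      change pt x' 0 + pt 0 y = pt x' y
      rw [pt_add, add_zero, zero_add]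
    rwa [h2] at h1
  have h1 := (hd (pt x y)).hasGradientAt.hasFDerivAt.comp x hι
  rw [hasGradientAt_iff_hasFDerivAt]
  refine h1.congr_fderiv ?_
  ext v
  change inner ℝ (gradient h (pt x y)) (pt v 0) = inner ℝ (grad1 h x y) v
  rw [inner_pt, inner_zero_right, add_zero]
  rfl

theorem hasGradientAt_right {h : Joint m n → ℝ} (hd : Differentiable ℝ h) (x : Vec m) (y : Vec n) :
    HasGradientAt (fun y' => h (pt x y')) (grad2 h x y) y := by
  let ι : Vec n →L[ℝ] Joint m n :=
    (WithLp.prodContinuousLinearEquiv 2 ℝ (Vec m) (Vec n)).symm.toContinuousLinearMap.comp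
      (ContinuousLinearMap.inr ℝ _ _)
  have hι : HasFDerivAt (fun y' : Vec n => pt x y') ι y := by
    have h1 := (ι.hasFDerivAt (x := y)).add_const (pt x 0)
    have h2 : (fun y' => ι y' + pt x 0) = fun y' : Vec n => pt x y' := by
      funext y'
      change pt 0 y' + pt x 0 = pt x y'
      rw [pt_add, add_zero, zero_add]
    rwa [h2] at h1
  have h1 := (hd (pt x y)).hasGradientAt.hasFDerivAt.comp y hι
  rw [hasGradientAt_iff_hasFDerivAt]
  refine h1.congr_fderiv ?_
  ext v
  change inner ℝ (gradient h (pt x y)) (pt 0 v) = inner ℝ (grad2 h x y) v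
  rw [inner_pt, inner_zero_right, zero_add]
  rfl

theorem norm_grad1_sub_le {h : Joint m n → ℝ} {L : ℝ}
    (hL : ∀ p q, ‖gradient h p - gradient h q‖ ≤ L * ‖p - q‖) (x x' : Vec m) (y y' : Vec n) :
    ‖grad1 h x y - grad1 h x' y'‖ ≤ L * ‖pt x y - pt x' y'‖ := by
  have h1 : grad1 h x y - grad1 h x' y' =
      (gradient h (pt x y) - gradient h (pt x' y')).fst := (WithLp.sub_fst ..).symm
  rw [h1]
  exact (norm_fst_le _).trans (hL _ _)

theorem norm_grad2_sub_le {h : Joint m n → ℝ} {L : ℝ}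
    (hL : ∀ p q, ‖gradient h p - gradient h q‖ ≤ L * ‖p - q‖) (x x' : Vec m) (y y' : Vec n) :
    ‖grad2 h x y - grad2 h x' y'‖ ≤ L * ‖pt x y - pt x' y'‖ := by
  have h1 : grad2 h x y - grad2 h x' y' =
      (gradient h (pt x y) - gradient h (pt x' y')).snd := (WithLp.sub_snd ..).symm
  rw [h1]
  exact (norm_snd_le _).trans (hL _ _)

theorem norm_pt_sub_left (x x' : Vec m) (y : Vec n) : ‖pt x y - pt x' y‖ = ‖x - x'‖ := by
  rw [pt_sub, sub_self, norm_pt_zero_right]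

theorem norm_pt_sub_right (x : Vec m) (y y' : Vec n) : ‖pt x y - pt x y'‖ = ‖y - y'‖ := by
  rw [pt_sub, sub_self, norm_pt_zero_left]

end Points

/-- The hypergradient `∇₁ f(x, y*(x)) - ∇²₁₂ g(x, y*(x)) u*(x)`. -/
def hypergradient {m n : ℕ} (f g : Joint m n → ℝ) (x : Vec m) : Vec m :=
  grad1 f x (yStar g x) - jac12 g x (yStar g x) (uStar f g x)

namespace Assumptions

variable {m n : ℕ} {f g : Joint m n → ℝ} {μ Lf1 Lg1 Lg2 Lf0 Cf0 : ℝ}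

theorem hasGradientAt_g (hA : Assumptions f g μ Lf1 Lg1 Lg2 Lf0 Cf0) (x : Vec m) (y : Vec n) :
    HasGradientAt (fun y' => g (pt x y')) (grad2 g x y) y :=
  hasGradientAt_right hA.g_diff x y

theorem hasFDerivAt_grad1 (hA : Assumptions f g μ Lf1 Lg1 Lg2 Lf0 Cf0) (x : Vec m) (y : Vec n) :
    HasFDerivAt (fun y' => grad1 g x y') (jac12 g x y) y :=
  (((WithLp.fstL 2 ℝ (Vec m) (Vec n)).differentiableAt).comp y (hA.g_diff2 x y)).hasFDerivAt

theorem hasFDerivAt_grad2 (hA : Assumptions f g μ Lf1 Lg1 Lg2 Lf0 Cf0) (x : Vec m) (y : Vec n) :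
    HasFDerivAt (fun y' => grad2 g x y') (hess22 g x y) y :=
  (((WithLp.sndL 2 ℝ (Vec m) (Vec n)).differentiableAt).comp y (hA.g_diff2 x y)).hasFDerivAt

theorem hess_isSymmetric (hA : Assumptions f g μ Lf1 Lg1 Lg2 Lf0 Cf0) (x : Vec m) (y : Vec n) :
    (hess22 g x y).toLinearMap.IsSymmetric :=
  isSymmetric_of_hasGradientAt (hA.hasGradientAt_g x) (hA.hasFDerivAt_grad2 x y)

theorem hess_coercive (hA : Assumptions f g μ Lf1 Lg1 Lg2 Lf0 Cf0) (x : Vec m) (y v : Vec n) :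
    μ * ‖v‖ ^ 2 ≤ inner ℝ (hess22 g x y v) v :=
  coercive_of_hasGradientAt (hA.g_strong x) (hA.hasGradientAt_g x) (hA.hasFDerivAt_grad2 x y) v

theorem le_norm_hess (hA : Assumptions f g μ Lf1 Lg1 Lg2 Lf0 Cf0) (x : Vec m) (y v : Vec n) :
    μ * ‖v‖ ≤ ‖hess22 g x y v‖ :=
  norm_le_of_coercive (hA.hess_coercive x y) v

theorem norm_hess_le (hA : Assumptions f g μ Lf1 Lg1 Lg2 Lf0 Cf0) (hL : 0 ≤ Lg1) (x : Vec m)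
    (y : Vec n) : ‖hess22 g x y‖ ≤ Lg1 :=
  (hA.hasFDerivAt_grad2 x y).le_of_lip' hL (Filter.Eventually.of_forall fun y' => by
    have := norm_grad2_sub_le hA.g_grad_lip x x y' y
    rwa [norm_pt_sub_right] at this)

theorem norm_jac_le (hA : Assumptions f g μ Lf1 Lg1 Lg2 Lf0 Cf0) (hL : 0 ≤ Lg1) (x : Vec m)
    (y : Vec n) : ‖jac12 g x y‖ ≤ Lg1 :=
  (hA.hasFDerivAt_grad1 x y).le_of_lip' hL (Filter.Eventually.of_forall fun y' => by
    have := norm_grad1_sub_le hA.g_grad_lip x x y' y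
    rwa [norm_pt_sub_right] at this)

theorem inner_hess_le (hA : Assumptions f g μ Lf1 Lg1 Lg2 Lf0 Cf0) (hL : 0 ≤ Lg1) (x : Vec m)
    (y v : Vec n) : inner ℝ (hess22 g x y v) v ≤ Lg1 * ‖v‖ ^ 2 := by
  calc _ ≤ ‖hess22 g x y v‖ * ‖v‖ := real_inner_le_norm _ _
    _ ≤ Lg1 * ‖v‖ * ‖v‖ := by
      gcongr
      exact ((hess22 g x y).le_opNorm v).trans (by gcongr; exact hA.norm_hess_le hL x y)
    _ = _ := by ring

theorem exists_hess_eq (hA : Assumptions f g μ Lf1 Lg1 Lg2 Lf0 Cf0) (hμ : 0 < μ) (x : Vec m)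
    (y b : Vec n) : ∃ v, hess22 g x y v = b := by
  obtain ⟨e, he⟩ := isInvertible_of_coercive hμ (hA.hess_coercive x y)
  exact ⟨e.symm b, by rw [← he]; simp⟩

theorem yStar_le (hA : Assumptions f g μ Lf1 Lg1 Lg2 Lf0 Cf0) (hμ : 0 < μ) (x : Vec m)
    (z : Vec n) : g (pt x (yStar g x)) ≤ g (pt x z) :=
  Classical.epsilon_spec (p := fun y => ∀ z, g (pt x y) ≤ g (pt x z))
    (exists_forall_le_of_strongConvexOn hμ (hA.g_strong x)
      fun y => (hA.hasGradientAt_g x y).differentiableAt) z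

theorem grad2_yStar (hA : Assumptions f g μ Lf1 Lg1 Lg2 Lf0 Cf0) (hμ : 0 < μ) (x : Vec m) :
    grad2 g x (yStar g x) = 0 :=
  gradient_eq_zero_of_forall_le (hA.hasGradientAt_g x _) (hA.yStar_le hμ x)

theorem norm_sub_yStar_le (hA : Assumptions f g μ Lf1 Lg1 Lg2 Lf0 Cf0) (hμ : 0 < μ) (x : Vec m)
    (y : Vec n) : μ * ‖y - yStar g x‖ ≤ ‖grad2 g x y‖ := by
  have h1 := strongConvexOn_inner_gradient (hA.g_strong x) (hA.hasGradientAt_g x y)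
    (hA.hasGradientAt_g x (yStar g x))
  rw [hA.grad2_yStar hμ, sub_zero] at h1
  have h2 := real_inner_le_norm (grad2 g x y) (y - yStar g x)
  rcases (norm_nonneg (y - yStar g x)).eq_or_lt with h0 | h0
  · rw [← h0]; simp
  · nlinarith

/-- Both problems are compared at the single point `yStar g x`: there the gradient for x vanishes,
so the one for x' is at most `Lg1` times ‖x - x'‖, and the error bound for x' applies. -/
theorem norm_yStar_sub_le (hA : Assumptions f g μ Lf1 Lg1 Lg2 Lf0 Cf0) (hμ : 0 < μ)
    (x x' : Vec m) : ‖yStar g x - yStar g x'‖ ≤ Lg1 / μ * ‖x - x'‖ := by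
  have h1 := hA.norm_sub_yStar_le hμ x' (yStar g x)
  have h2 := norm_grad2_sub_le hA.g_grad_lip x x' (yStar g x) (yStar g x)
  rw [hA.grad2_yStar hμ, zero_sub, norm_neg, norm_pt_sub_left] at h2
  rw [div_mul_eq_mul_div, le_div_iff₀ hμ]
  linarith

theorem hess_uStar (hA : Assumptions f g μ Lf1 Lg1 Lg2 Lf0 Cf0) (hμ : 0 < μ) (x : Vec m) :
    hess22 g x (yStar g x) (uStar f g x) = grad2 f x (yStar g x) :=
  (((isInvertible_of_coercive hμ (hA.hess_coercive x (yStar g x))).inverse_apply_eq).1 rfl).symm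

theorem norm_uStar_le (hA : Assumptions f g μ Lf1 Lg1 Lg2 Lf0 Cf0) (hμ : 0 < μ) (x : Vec m) :
    ‖uStar f g x‖ ≤ Lf0 / μ := by
  have h1 := hA.le_norm_hess x (yStar g x) (uStar f g x)
  rw [hA.hess_uStar hμ] at h1
  rw [le_div_iff₀ hμ]
  linarith [hA.f_grad2_bound x]

/-- Perturbation bound for the linear system that defines `u*`. -/
theorem norm_sub_uStar_le (hA : Assumptions f g μ Lf1 Lg1 Lg2 Lf0 Cf0) (hμ : 0 < μ)
    (hLg2 : 0 ≤ Lg2) (x x' : Vec m) (y w : Vec n) (hw : hess22 g x y w = grad2 f x y) :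
    ‖w - uStar f g x'‖ ≤
      (Lf1 + Lg2 * (Lf0 / μ)) / μ * ‖pt x y - pt x' (yStar g x')‖ := by
  have h1 := hA.le_norm_hess x y (w - uStar f g x')
  have h2 : hess22 g x y (w - uStar f g x') = (grad2 f x y - grad2 f x' (yStar g x'))
      - (hess22 g x y - hess22 g x' (yStar g x')) (uStar f g x') := by
    rw [map_sub, hw, sub_apply, hA.hess_uStar hμ]
    abel
  have h3 := norm_grad2_sub_le hA.f_grad_lip x x' y (yStar g x')
  have h4 : ‖(hess22 g x y - hess22 g x' (yStar g x')) (uStar f g x')‖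
      ≤ Lg2 * ‖pt x y - pt x' (yStar g x')‖ * (Lf0 / μ) :=
    (ContinuousLinearMap.le_opNorm _ _).trans
      (mul_le_mul (hA.g_hess_lip _ _ _ _) (hA.norm_uStar_le hμ x') (norm_nonneg _)
        (by positivity))
  have h5 := norm_sub_le (grad2 f x y - grad2 f x' (yStar g x'))
    ((hess22 g x y - hess22 g x' (yStar g x')) (uStar f g x'))
  rw [h2] at h1
  rw [div_mul_eq_mul_div, le_div_iff₀ hμ]
  calc _ = μ * ‖w - uStar f g x'‖ := by ring
    _ ≤ Lf1 * ‖pt x y - pt x' (yStar g x')‖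
        + Lg2 * ‖pt x y - pt x' (yStar g x')‖ * (Lf0 / μ) := by linarith
    _ = _ := by ring

theorem norm_uStar_sub_le (hA : Assumptions f g μ Lf1 Lg1 Lg2 Lf0 Cf0) (hμ : 0 < μ)
    (hLf1 : 0 ≤ Lf1) (hLg2 : 0 ≤ Lg2) (hLf0 : 0 ≤ Lf0) (x x' : Vec m) :
    ‖uStar f g x - uStar f g x'‖ ≤
      (Lf1 + Lg2 * (Lf0 / μ)) / μ * ((1 + Lg1 / μ) * ‖x - x'‖) := by
  refine (hA.norm_sub_uStar_le hμ hLg2 x x' _ _ (hA.hess_uStar hμ x)).trans ?_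
  gcongr
  rw [pt_sub]
  refine (norm_pt_le _ _).trans ?_
  linarith [hA.norm_yStar_sub_le hμ x x']

/-- Quadratic convergence of Newton's method: the Hessian applied to the new error is exactly the
Taylor remainder of ∇₂g between y and `yStar`. -/
theorem norm_newton_sub_le (hA : Assumptions f g μ Lf1 Lg1 Lg2 Lf0 Cf0) (hμ : 0 < μ)
    (x : Vec m) (y v : Vec n) (hv : hess22 g x y v = grad2 g x y) :
    ‖y - v - yStar g x‖ ≤ Lg2 / (2 * μ) * ‖y - yStar g x‖ ^ 2 := by
  have h1 := hA.le_norm_hess x y (y - v - yStar g x)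
  have h2 := norm_taylor_le (hA.hasFDerivAt_grad2 x) (fun y z => by
    have := hA.g_hess_lip x y x z
    rwa [norm_pt_sub_right] at this) y (yStar g x - y)
  rw [add_sub_cancel, hA.grad2_yStar hμ] at h2
  have h3 : hess22 g x y (y - v - yStar g x)
      = 0 - grad2 g x y - hess22 g x y (yStar g x - y) := by
    rw [map_sub, map_sub, map_sub, hv]
    abel
  rw [h3] at h1
  rw [norm_sub_rev (yStar g x) y] at h2
  rw [div_mul_eq_mul_div, le_div_iff₀ (by positivity)]
  linarith

/-- The mixed second derivative: `∇₂ g(·, y)` is differentiable in the direction `u`, with gradient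
`∇²₁₂ g(x, y) u`. -/
theorem abs_cross_taylor_le (hA : Assumptions f g μ Lf1 Lg1 Lg2 Lf0 Cf0)
    (x h : Vec m) (y u : Vec n) :
    |inner ℝ (grad2 g (x + h) y - grad2 g x y) u - inner ℝ (jac12 g x y u) h|
      ≤ Lg2 / 2 * ‖h‖ ^ 2 * ‖u‖ := by
  -- the mixed difference, as a function of the position between `x` and `x + h`
  have hmixed : ∀ t : ℝ, 0 < t →
      |(g (pt (x + h) (y + t • u)) - g (pt (x + h) y)) - (g (pt x (y + t • u)) - g (pt x y))
        - t * inner ℝ (jac12 g x y u) h|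
      ≤ Lg2 / 2 * t ^ 2 * ‖u‖ ^ 2 * ‖h‖ + t * (Lg2 / 2 * ‖h‖ ^ 2 * ‖u‖) := by
    intro t ht
    have hγ : ∀ s : ℝ, HasDerivAt (fun s : ℝ => g (pt (x + s • h) (y + t • u)) - g (pt (x + s • h) y)
        - s * (t * inner ℝ (jac12 g x y u) h))
        (inner ℝ (grad1 g (x + s • h) (y + t • u) - grad1 g (x + s • h) y - t • jac12 g x y u) h)
        s := by
      intro s
      have h1 := HasGradientAt.hasDerivAt_line s h
        (hasGradientAt_left hA.g_diff (x + s • h) (y + t • u))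
      have h2 := HasGradientAt.hasDerivAt_line s h (hasGradientAt_left hA.g_diff (x + s • h) y)
      have h3 := (hasDerivAt_id s).mul_const (t * inner ℝ (jac12 g x y u) h)
      refine ((h1.sub h2).sub h3).congr_deriv ?_
      rw [inner_sub_left, inner_sub_left, real_inner_smul_left, one_mul]
    have key := norm_image_one_sub_le (A := Lg2 / 2 * t ^ 2 * ‖u‖ ^ 2 * ‖h‖)
      (C := t * (Lg2 * ‖h‖ ^ 2 * ‖u‖)) hγ (fun s hs => by
        have h1 := norm_taylor_le (hA.hasFDerivAt_grad1 (x + s • h)) (fun y z => by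
          have := hA.g_jac_lip (x + s • h) y (x + s • h) z
          rwa [norm_pt_sub_right] at this) y (t • u)
        have h2 : ‖(jac12 g (x + s • h) y - jac12 g x y) (t • u)‖
            ≤ Lg2 * (s * ‖h‖) * (t * ‖u‖) := by
          have h3 := hA.g_jac_lip (x + s • h) y x y
          rw [norm_pt_sub_left, add_sub_cancel_left, norm_smul, Real.norm_of_nonneg hs] at h3
          have h4 : ‖t • u‖ = t * ‖u‖ := by rw [norm_smul, Real.norm_of_nonneg ht.le]
          refine (ContinuousLinearMap.le_opNorm _ _).trans ?_
          rw [h4]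
          gcongr
        rw [norm_smul, Real.norm_of_nonneg ht.le] at h1
        have h5 : grad1 g (x + s • h) (y + t • u) - grad1 g (x + s • h) y - t • jac12 g x y u
            = (grad1 g (x + s • h) (y + t • u) - grad1 g (x + s • h) y
                - jac12 g (x + s • h) y (t • u))
              + (jac12 g (x + s • h) y - jac12 g x y) (t • u) := by
          rw [sub_apply, map_smul (jac12 g x y)]
          abel
        have h6 := norm_add_le (grad1 g (x + s • h) (y + t • u) - grad1 g (x + s • h) y
                - jac12 g (x + s • h) y (t • u)) ((jac12 g (x + s • h) y - jac12 g x y) (t • u))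
        rw [← h5] at h6
        refine (norm_inner_le_norm _ _).trans ?_
        calc _ ≤ (Lg2 / 2 * (t * ‖u‖) ^ 2 + Lg2 * (s * ‖h‖) * (t * ‖u‖)) * ‖h‖ := by
              gcongr
              linarith
          _ = _ := by ring)
    rw [Real.norm_eq_abs] at key
    simp only [one_smul, one_mul, zero_smul, add_zero, zero_mul, sub_zero] at key
    convert key using 1
    · congr 1
      ring
    · ring
  -- Second derivatives are assumed in y only, so ∇₂g need not be differentiable in x. The mixed
  -- difference, estimated above through ∇₁g, is therefore divided by t: as t → 0 it becomes the
  -- increment of ∇₂g in x, and the term quadratic in t disappears.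
  have hd : HasDerivAt (fun t : ℝ => g (pt (x + h) (y + t • u)) - g (pt x (y + t • u)))
      (inner ℝ (grad2 g (x + h) y - grad2 g x y) u) 0 := by
    rw [inner_sub_left]
    exact (HasGradientAt.hasDerivAt_line 0 u (by simpa using hA.hasGradientAt_g (x + h) y)).sub
      (HasGradientAt.hasDerivAt_line 0 u (by simpa using hA.hasGradientAt_g x y))
  have hlim := (hd.tendsto_slope_zero_right.sub_const (inner ℝ (jac12 g x y u) h)).abs
  have hlim2 : Filter.Tendsto (fun t : ℝ => Lg2 / 2 * t * ‖u‖ ^ 2 * ‖h‖ + Lg2 / 2 * ‖h‖ ^ 2 * ‖u‖)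
      (nhdsWithin 0 (Ioi 0))
      (nhds (Lg2 / 2 * 0 * ‖u‖ ^ 2 * ‖h‖ + Lg2 / 2 * ‖h‖ ^ 2 * ‖u‖)) :=
    Filter.Tendsto.mono_left (Continuous.tendsto (by fun_prop) 0) nhdsWithin_le_nhds
  have hle := le_of_tendsto_of_tendsto hlim hlim2 (by
    filter_upwards [self_mem_nhdsWithin] with t ht
    have ht0 : (0 : ℝ) < t := ht
    have h1 := hmixed t ht0
    simp only [zero_add, zero_smul, add_zero, smul_eq_mul]
    have h2 : (g (pt (x + h) (y + t • u)) - g (pt (x + h) y)) - (g (pt x (y + t • u)) - g (pt x y))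
        - t * inner ℝ (jac12 g x y u) h
      = t * (t⁻¹ * (g (pt (x + h) (y + t • u)) - g (pt x (y + t • u))
          - (g (pt (x + h) y) - g (pt x y))) - inner ℝ (jac12 g x y u) h) := by
      field_simp
      ring
    rw [h2, abs_mul, abs_of_pos ht0] at h1
    refine le_of_mul_le_mul_left (h1.trans_eq ?_) ht0
    ring)
  simpa using hle

/-- The second-order expansion of `∇₂ g` around `(x, y)`, tested against `u`. -/
theorem abs_inner_grad2_taylor_le (hA : Assumptions f g μ Lf1 Lg1 Lg2 Lf0 Cf0)
    (x h : Vec m) (y k u : Vec n) :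
    |inner ℝ (grad2 g (x + h) (y + k) - grad2 g x y) u - inner ℝ (jac12 g x y u) h
        - inner ℝ (hess22 g x y k) u|
      ≤ Lg2 / 2 * (‖h‖ + ‖k‖) ^ 2 * ‖u‖ := by
  have h1 := hA.abs_cross_taylor_le x h y u
  have h2 := norm_taylor_le (hA.hasFDerivAt_grad2 (x + h)) (fun y z => by
    have := hA.g_hess_lip (x + h) y (x + h) z
    rwa [norm_pt_sub_right] at this) y k
  have h3 : ‖(hess22 g (x + h) y - hess22 g x y) k‖ ≤ Lg2 * ‖h‖ * ‖k‖ := by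
    have h4 := hA.g_hess_lip (x + h) y x y
    rw [norm_pt_sub_left, add_sub_cancel_left] at h4
    refine (ContinuousLinearMap.le_opNorm _ _).trans ?_
    gcongr
  have h4 := (abs_real_inner_le_norm (grad2 g (x + h) (y + k) - grad2 g (x + h) y
    - hess22 g (x + h) y k) u).trans (mul_le_mul_of_nonneg_right h2 (norm_nonneg u))
  have h5 := (abs_real_inner_le_norm ((hess22 g (x + h) y - hess22 g x y) k) u).trans
    (mul_le_mul_of_nonneg_right h3 (norm_nonneg u))
  rw [sub_apply] at h5
  simp only [inner_sub_left] at h1 h4 h5 ⊢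
  rw [abs_le] at h1 h4 h5 ⊢
  -- The errors ‖h‖²/2, ‖k‖²/2 and ‖h‖‖k‖ add up to (‖h‖ + ‖k‖)²/2.
  constructor <;> linarith [h1.1, h1.2, h4.1, h4.2, h5.1, h5.2]

/-- The quadratic bound that yields differentiability and smoothness of `Φ`. -/
theorem abs_Phi_taylor_le (hA : Assumptions f g μ Lf1 Lg1 Lg2 Lf0 Cf0) (hμ : 0 < μ)
    (hLf1 : 0 ≤ Lf1) (hLg2 : 0 ≤ Lg2) {κ : ℝ} (hκ : 1 ≤ κ) (hLκ : Lg1 / μ ≤ κ)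
    (x h : Vec m) :
    |Phi f g (x + h) - Phi f g x - inner ℝ (hypergradient f g x) h|
      ≤ 3 * (Lf1 + Lg2 * (Lf0 / μ)) * κ ^ 2 * ‖h‖ ^ 2 := by
  obtain ⟨k, hk⟩ : ∃ k, yStar g (x + h) = yStar g x + k := ⟨_, (add_sub_cancel _ _).symm⟩
  have hkn : ‖k‖ ≤ κ * ‖h‖ := by
    have h1 := hA.norm_yStar_sub_le hμ (x + h) x
    rw [hk, add_sub_cancel_left, add_sub_cancel_left] at h1
    exact h1.trans (by gcongr)
  have hf := abs_taylor_gradient_le (fun p => (hA.f_diff p).hasGradientAt) hA.f_grad_lip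
    (pt x (yStar g x)) (pt h k)
  rw [norm_pt_sq, inner_pt, pt_add] at hf
  -- ∇₂g vanishes at both lower-level solutions. Tested against `uStar`, its expansion therefore
  -- says that ⟨∇₂f, k⟩ equals -⟨∇²₁₂g u*, h⟩ up to a quadratic error, which turns the linear part
  -- of f into that of the hypergradient.
  have hg := hA.abs_inner_grad2_taylor_le x h (yStar g x) k (uStar f g x)
  rw [← hk, hA.grad2_yStar hμ, hA.grad2_yStar hμ, sub_zero, inner_zero_left,
    show inner ℝ (hess22 g x (yStar g x) k) (uStar f g x)
      = inner ℝ k (hess22 g x (yStar g x) (uStar f g x)) from hA.hess_isSymmetric _ _ _ _,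
    hA.hess_uStar hμ, real_inner_comm (grad2 f x (yStar g x)) k] at hg
  have hu := hA.norm_uStar_le hμ x
  have hh := norm_nonneg h
  have hu0 := norm_nonneg (uStar f g x)
  have hκh : ‖h‖ ≤ κ * ‖h‖ := by nlinarith
  have hb1 : ‖h‖ ^ 2 + ‖k‖ ^ 2 ≤ 2 * (κ * ‖h‖) ^ 2 := by
    have : ‖h‖ ^ 2 ≤ (κ * ‖h‖) ^ 2 := by gcongr
    have : ‖k‖ ^ 2 ≤ (κ * ‖h‖) ^ 2 := by gcongr
    linarith
  have hb2 : (‖h‖ + ‖k‖) ^ 2 ≤ 4 * (κ * ‖h‖) ^ 2 := by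
    calc _ ≤ (κ * ‖h‖ + κ * ‖h‖) ^ 2 := by gcongr
      _ = _ := by ring
  have hb3 : Lg2 / 2 * (‖h‖ + ‖k‖) ^ 2 * ‖uStar f g x‖
      ≤ Lg2 / 2 * (4 * (κ * ‖h‖) ^ 2) * (Lf0 / μ) := by gcongr
  have hb4 : Lf1 / 2 * (‖h‖ ^ 2 + ‖k‖ ^ 2) ≤ Lf1 / 2 * (2 * (κ * ‖h‖) ^ 2) := by gcongr
  have hL0 : 0 ≤ Lf0 / μ := hu0.trans hu
  have hp1 : 0 ≤ Lf1 * (κ * ‖h‖) ^ 2 := by positivity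
  have hp2 : 0 ≤ Lg2 * (Lf0 / μ) * (κ * ‖h‖) ^ 2 := by positivity
  have hPhi : Phi f g (x + h) - Phi f g x = f (pt (x + h) (yStar g x + k)) - f (pt x (yStar g x)) := by
    rw [Phi, Phi, hk]
  rw [hPhi, hypergradient, inner_sub_left]
  change |_ - _ - (inner ℝ (grad1 f x (yStar g x)) h + inner ℝ (grad2 f x (yStar g x)) k)| ≤ _ at hf
  rw [abs_le] at hf hg ⊢
  constructor <;> nlinarith [hf.1, hf.2, hg.1, hg.2]

theorem hasGradientAt_Phi (hA : Assumptions f g μ Lf1 Lg1 Lg2 Lf0 Cf0) (hμ : 0 < μ)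
    (hLf1 : 0 ≤ Lf1) (hLg2 : 0 ≤ Lg2) (x : Vec m) :
    HasGradientAt (Phi f g) (hypergradient f g x) x := by
  rw [hasGradientAt_iff_isLittleO_nhds_zero]
  set κ := max 1 (Lg1 / μ)
  have h1 : (fun h => Phi f g (x + h) - Phi f g x - inner ℝ (hypergradient f g x) h)
      =O[nhds 0] fun h => ‖h‖ ^ 2 := by
    refine Asymptotics.IsBigO.of_bound (3 * (Lf1 + Lg2 * (Lf0 / μ)) * κ ^ 2)
      (Filter.Eventually.of_forall fun h => ?_)
    rw [Real.norm_eq_abs, Real.norm_of_nonneg (by positivity)]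
    exact hA.abs_Phi_taylor_le hμ hLf1 hLg2 (le_max_left _ _) (le_max_right _ _) x h
  exact h1.trans_isLittleO (Asymptotics.isLittleO_norm_pow_id one_lt_two)

/-- The error of the approximate hypergradient. -/
theorem norm_sub_hypergradient_le (hA : Assumptions f g μ Lf1 Lg1 Lg2 Lf0 Cf0) (hμ : 0 < μ)
    (hLg1 : 0 ≤ Lg1) (hLg2 : 0 ≤ Lg2) (x : Vec m) (y u : Vec n) :
    ‖grad1 f x y - jac12 g x y u - hypergradient f g x‖ ≤
      (Lf1 + Lg2 * (Lf0 / μ)) * ‖y - yStar g x‖ + Lg1 * ‖u - uStar f g x‖ := by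
  have h1 := norm_grad1_sub_le hA.f_grad_lip x x y (yStar g x)
  rw [norm_pt_sub_right] at h1
  have h2 : ‖(jac12 g x y - jac12 g x (yStar g x)) (uStar f g x)‖
      ≤ Lg2 * ‖y - yStar g x‖ * (Lf0 / μ) := by
    have h3 := hA.g_jac_lip x y x (yStar g x)
    rw [norm_pt_sub_right] at h3
    exact (ContinuousLinearMap.le_opNorm _ _).trans
      (mul_le_mul h3 (hA.norm_uStar_le hμ x) (norm_nonneg _) (by positivity))
  have h3 : ‖jac12 g x y (u - uStar f g x)‖ ≤ Lg1 * ‖u - uStar f g x‖ :=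
    (ContinuousLinearMap.le_opNorm _ _).trans (by gcongr; exact hA.norm_jac_le hLg1 x y)
  have h4 : grad1 f x y - jac12 g x y u - hypergradient f g x
      = (grad1 f x y - grad1 f x (yStar g x))
        - (jac12 g x y - jac12 g x (yStar g x)) (uStar f g x)
        - jac12 g x y (u - uStar f g x) := by
    rw [hypergradient, sub_apply, map_sub]
    abel
  rw [h4]
  refine (norm_sub_le _ _).trans ?_
  have h5 := norm_sub_le (grad1 f x y - grad1 f x (yStar g x))
    ((jac12 g x y - jac12 g x (yStar g x)) (uStar f g x))
  linarith

end Assumptions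

/-! ### One outer iteration -/

theorem nboStep_val {m n : ℕ} (f g : Joint m n → ℝ) (α : ℝ) (T : ℕ) (s : Iterate m n) :
    (nboStep f g α T s).val =
      ⟨s.x - α • (grad1 f s.x s.y - jac12 g s.x s.y s.u),
        s.y - (cg (askHess g s.x s.y) (grad2 g s.x s.y) T).val,
        s.u - (cg (askHess g s.x s.y) (hess22 g s.x s.y s.u - grad2 f s.x s.y) T).val⟩ :=
  rfl

theorem nboCG_succ_val {m n : ℕ} (f g : Joint m n → ℝ) (α : ℝ) (T : ℕ) (s : Iterate m n) (k : ℕ) :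
    (nboCG f g α T s (k + 1)).val = (nboStep f g α T (nboCG f g α T s k).val).val := by
  rw [nboCG, bind_val]

/-- The requirements on the condition number `κ`, the step size `α` and the number `T` of inner
iterations, with `L₁ = L_{f,1} + L_{g,2} L_{f,0} / μ`. -/
structure StepConditions (μ Lf1 Lg1 Lg2 Lf0 Cf0 L1 κ α : ℝ) (T : ℕ) : Prop where
  L1_eq : L1 = Lf1 + Lg2 * (Lf0 / μ)
  one_le : 1 ≤ κ
  Lg1_le : Lg1 ≤ κ * μ
  α_pos : 0 < α
  inner_iterations : 4 * (√κ * (1 + Real.log κ)) ≤ T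
  -- The bracket after α bounds the length of the update direction inside the box. The two
  -- conditions keep the drift of `yStar` below half, and that of `uStar` below a quarter, of the
  -- corresponding box radius.
  move_y : κ * (α * (Cf0 + Lg1 * (Lf0 / μ + 5 * L1 / (2 * Lg2)))) ≤
    min (μ / (2 * Lg2)) (1 / (2 * √L1)) / 2
  move_u : L1 / μ * (2 * κ) * (α * (Cf0 + Lg1 * (Lf0 / μ + 5 * L1 / (2 * Lg2)))) ≤
    min (5 * L1 / (2 * Lg2)) (√L1 / μ) / 4
  contract : 60 * (κ ^ 2 * L1 * α) ≤ 1

/-- The potential is φ + (5/2)αe². The weight 5/2 is the fixed point of w ↦ (4/5)w + 1/2, so the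
error terms cancel, and the αd²/8 created by the recursion is covered by the αd²/4 gained in the
descent. -/
theorem exists_norm_sq_le_of_lyapunov {e d G φ : ℕ → ℝ} {α φs : ℝ} (hα : 0 < α)
    (he0 : ∀ k, 0 ≤ e k)
    (he : ∀ k, e (k + 1) ≤ 4 / 5 * e k + 1 / 10 * d k)
    (hφ : ∀ k, φ (k + 1) ≤ φ k - α / 2 * G k ^ 2 - α / 4 * d k ^ 2 + α / 2 * e k ^ 2)
    (hφs : ∀ k, φs ≤ φ k) (hinit : 5 / 2 * α * e 0 ^ 2 ≤ 2) {K : ℕ} (hK : 1 ≤ K) :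
    ∃ k < K, G k ^ 2 ≤ (2 * φ 0 - 2 * φs + 4) / (α * K) := by
  have hstep : ∀ k, φ (k + 1) + 5 / 2 * α * e (k + 1) ^ 2 + α / 2 * G k ^ 2
      ≤ φ k + 5 / 2 * α * e k ^ 2 := by
    intro k
    have h1 : e (k + 1) ^ 2 ≤ 4 / 5 * e k ^ 2 + 1 / 20 * d k ^ 2 := by
      calc _ ≤ (4 / 5 * e k + 1 / 10 * d k) ^ 2 := by
            gcongr
            · exact he0 _
            · exact he k
        _ ≤ _ := by nlinarith [sq_nonneg (2 / 5 * e k - 1 / 5 * d k)]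
    have h2 : 5 / 2 * α * e (k + 1) ^ 2 ≤ 5 / 2 * α * (4 / 5 * e k ^ 2 + 1 / 20 * d k ^ 2) := by
      gcongr
    have h3 : 0 ≤ α * d k ^ 2 := by positivity
    linarith [hφ k]
  have hsum : ∀ K : ℕ, φ K + 5 / 2 * α * e K ^ 2 + α / 2 * ∑ k ∈ Finset.range K, G k ^ 2
      ≤ φ 0 + 5 / 2 * α * e 0 ^ 2 := by
    intro K
    induction K with
    | zero => simp
    | succ K ih =>
      rw [Finset.sum_range_succ]
      linarith [hstep K]
  by_contra! hcon
  have hK0 : (0 : ℝ) < K := by exact_mod_cast hK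
  have h1 : ∑ k ∈ Finset.range K, (2 * φ 0 - 2 * φs + 4) / (α * K) <
      ∑ k ∈ Finset.range K, G k ^ 2 :=
    Finset.sum_lt_sum_of_nonempty (Finset.nonempty_range_iff.2 (by omega))
      fun k hk => hcon k (Finset.mem_range.1 hk)
  rw [Finset.sum_const, Finset.card_range, nsmul_eq_mul] at h1
  have h2 : (K : ℝ) * ((2 * φ 0 - 2 * φs + 4) / (α * K)) = (2 * φ 0 - 2 * φs + 4) / α := by
    field_simp
  rw [h2, div_lt_iff₀ hα] at h1
  have h3 : 0 ≤ 5 / 2 * α * e K ^ 2 := by positivity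
  linarith [hsum K, hφs K]

/-! ### Error contraction, invariance of the box and descent. -/

section Step

variable {m n : ℕ} {f g : Joint m n → ℝ} {μ Lf1 Lg1 Lg2 Lf0 Cf0 L1 κ α : ℝ} {T : ℕ}

theorem StepConditions.Lg1_div_le (hS : StepConditions μ Lf1 Lg1 Lg2 Lf0 Cf0 L1 κ α T)
    (hμ : 0 < μ) : Lg1 / μ ≤ κ := by
  rw [div_le_iff₀ hμ]; exact hS.Lg1_le

theorem Assumptions.norm_cg_sub_le (hA : Assumptions f g μ Lf1 Lg1 Lg2 Lf0 Cf0) (hμ : 0 < μ)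
    (hLg1 : 0 ≤ Lg1) (hS : StepConditions μ Lf1 Lg1 Lg2 Lf0 Cf0 L1 κ α T) (x : Vec m) (y : Vec n)
    {b v : Vec n} (hv : hess22 g x y v = b) :
    ‖(cg (askHess g x y) b T).val - v‖ ≤ 1 / 10 * ‖v‖ :=
  Bilevel.norm_cg_sub_le (hA.hess_isSymmetric x y) hμ (hA.hess_coercive x y)
    (hA.inner_hess_le hLg1 x y) hS.one_le hS.Lg1_le (fun _ => rfl) hv T hS.inner_iterations

/-- In the box an exact Newton step leaves a quarter of the error, so its length is at most 5/4 of
the error. Conjugate gradient adds a tenth of that, and 1/4 + 1/8 ≤ 1/2. The last term is the drift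
of `yStar`. -/
theorem Assumptions.norm_nboStep_y_le (hA : Assumptions f g μ Lf1 Lg1 Lg2 Lf0 Cf0) (hμ : 0 < μ)
    (hLg1 : 0 ≤ Lg1) (hLg2 : 0 < Lg2) (hS : StepConditions μ Lf1 Lg1 Lg2 Lf0 Cf0 L1 κ α T)
    (s : Iterate m n) (hy : ‖s.y - yStar g s.x‖ ≤ μ / (2 * Lg2)) :
    ‖(nboStep f g α T s).val.y - yStar g (nboStep f g α T s).val.x‖ ≤
      ‖s.y - yStar g s.x‖ / 2
        + κ * (α * ‖grad1 f s.x s.y - jac12 g s.x s.y s.u‖) := by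
  rw [nboStep_val]
  dsimp only
  obtain ⟨v₀, hv₀⟩ := hA.exists_hess_eq hμ s.x s.y (grad2 g s.x s.y)
  have h1 := hA.norm_cg_sub_le hμ hLg1 hS s.x s.y hv₀
  have h2 := hA.norm_newton_sub_le hμ s.x s.y v₀ hv₀
  set v := (cg (askHess g s.x s.y) (grad2 g s.x s.y) T).val
  set d := grad1 f s.x s.y - jac12 g s.x s.y s.u
  set P := ‖s.y - yStar g s.x‖
  have hP : 0 ≤ P := norm_nonneg _
  have h3 : Lg2 / (2 * μ) * P ^ 2 ≤ P / 4 := by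
    calc Lg2 / (2 * μ) * P ^ 2 = Lg2 / (2 * μ) * P * P := by ring
      _ ≤ Lg2 / (2 * μ) * (μ / (2 * Lg2)) * P := by gcongr
      _ = P / 4 := by field_simp; ring
  have h4 : ‖v₀‖ ≤ P + ‖s.y - v₀ - yStar g s.x‖ := by
    have : v₀ = (s.y - yStar g s.x) - (s.y - v₀ - yStar g s.x) := by abel
    conv_lhs => rw [this]
    exact norm_sub_le _ _
  have h5 := hA.norm_yStar_sub_le hμ (s.x - α • d) s.x
  rw [sub_sub_cancel_left, norm_neg, norm_smul, Real.norm_of_nonneg hS.α_pos.le] at h5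
  have h6 : Lg1 / μ * (α * ‖d‖) ≤ κ * (α * ‖d‖) := by
    have := hS.α_pos
    gcongr
    exact hS.Lg1_div_le hμ
  have h7 : s.y - v - yStar g (s.x - α • d) = (s.y - v₀ - yStar g s.x) - (v - v₀)
      - (yStar g (s.x - α • d) - yStar g s.x) := by abel
  rw [h7]
  have h8 := norm_sub_le ((s.y - v₀ - yStar g s.x) - (v - v₀))
    (yStar g (s.x - α • d) - yStar g s.x)
  have h9 := norm_sub_le (s.y - v₀ - yStar g s.x) (v - v₀)
  linarith

/-- With an exact solve the new u would solve the system at (x, y), where only the inexactness of y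
separates it from `uStar`. The solver adds a tenth of the length of the correction, and the last
term is the drift of `uStar`. -/
theorem Assumptions.norm_nboStep_u_le (hA : Assumptions f g μ Lf1 Lg1 Lg2 Lf0 Cf0) (hμ : 0 < μ)
    (hLf1 : 0 ≤ Lf1) (hLg1 : 0 ≤ Lg1) (hLg2 : 0 ≤ Lg2) (hLf0 : 0 ≤ Lf0)
    (hS : StepConditions μ Lf1 Lg1 Lg2 Lf0 Cf0 L1 κ α T) (s : Iterate m n) :
    ‖(nboStep f g α T s).val.u - uStar f g (nboStep f g α T s).val.x‖ ≤
      11 / 10 * (L1 / μ * ‖s.y - yStar g s.x‖) + 1 / 10 * ‖s.u - uStar f g s.x‖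
        + L1 / μ * (2 * κ) * (α * ‖grad1 f s.x s.y - jac12 g s.x s.y s.u‖) := by
  rw [nboStep_val]
  dsimp only
  obtain ⟨w₀, hw₀⟩ := hA.exists_hess_eq hμ s.x s.y (hess22 g s.x s.y s.u - grad2 f s.x s.y)
  have h1 := hA.norm_cg_sub_le hμ hLg1 hS s.x s.y hw₀
  have h2 := hA.norm_sub_uStar_le hμ hLg2 s.x s.x s.y (s.u - w₀) (by rw [map_sub, hw₀]; abel)
  rw [norm_pt_sub_right, ← hS.L1_eq] at h2
  set w := (cg (askHess g s.x s.y) (hess22 g s.x s.y s.u - grad2 f s.x s.y) T).val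
  set d := grad1 f s.x s.y - jac12 g s.x s.y s.u
  have h4 : ‖w₀‖ ≤ ‖s.u - uStar f g s.x‖ + ‖s.u - w₀ - uStar f g s.x‖ := by
    have : w₀ = (s.u - uStar f g s.x) - (s.u - w₀ - uStar f g s.x) := by abel
    conv_lhs => rw [this]
    exact norm_sub_le _ _
  have h5 := hA.norm_uStar_sub_le hμ hLf1 hLg2 hLf0 (s.x - α • d) s.x
  rw [sub_sub_cancel_left, norm_neg, norm_smul, Real.norm_of_nonneg hS.α_pos.le, ← hS.L1_eq] at h5
  have hL1 : 0 ≤ L1 := by rw [hS.L1_eq]; positivity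
  have h6 : L1 / μ * ((1 + Lg1 / μ) * (α * ‖d‖)) ≤ L1 / μ * (2 * κ) * (α * ‖d‖) := by
    have := hS.α_pos
    rw [mul_assoc (L1 / μ)]
    gcongr
    linarith [hS.one_le, hS.Lg1_div_le hμ]
  have h7 : s.u - w - uStar f g (s.x - α • d) = (s.u - w₀ - uStar f g s.x) - (w - w₀)
      - (uStar f g (s.x - α • d) - uStar f g s.x) := by abel
  rw [h7]
  have h8 := norm_sub_le ((s.u - w₀ - uStar f g s.x) - (w - w₀))
    (uStar f g (s.x - α • d) - uStar f g s.x)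
  have h9 := norm_sub_le (s.u - w₀ - uStar f g s.x) (w - w₀)
  linarith

/-- Within the box, the errors of `y` and `u` are coupled through half the radius for `u`. -/
theorem L1_div_mul_le (hμ : 0 < μ) (hLg2 : 0 < Lg2) (hL1 : 0 < L1) {P : ℝ}
    (hP : P ≤ min (μ / (2 * Lg2)) (1 / (2 * √L1))) :
    L1 / μ * P ≤ min (L1 / (2 * Lg2)) (√L1 / μ / 2) := by
  have hs : 0 < √L1 := Real.sqrt_pos.2 hL1
  refine le_min ?_ ?_
  · calc L1 / μ * P ≤ L1 / μ * (μ / (2 * Lg2)) := by gcongr; exact hP.trans (min_le_left _ _)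
      _ = _ := by field_simp
  · calc L1 / μ * P ≤ L1 / μ * (1 / (2 * √L1)) := by gcongr; exact hP.trans (min_le_right _ _)
      _ = √L1 * √L1 / μ * (1 / (2 * √L1)) := by rw [Real.mul_self_sqrt hL1.le]
      _ = _ := by field_simp

theorem Assumptions.norm_direction_le (hA : Assumptions f g μ Lf1 Lg1 Lg2 Lf0 Cf0) (hμ : 0 < μ)
    (hLg1 : 0 ≤ Lg1) (x : Vec m) (y u : Vec n) {r : ℝ} (hu : ‖u - uStar f g x‖ ≤ r) :
    ‖grad1 f x y - jac12 g x y u‖ ≤ Cf0 + Lg1 * (Lf0 / μ + r) := by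
  refine (norm_sub_le _ _).trans (add_le_add (hA.f_grad1_bound x y) ?_)
  have h1 : ‖u‖ ≤ Lf0 / μ + r := by
    have h2 := norm_add_le (uStar f g x) (u - uStar f g x)
    rw [add_sub_cancel] at h2
    linarith [hA.norm_uStar_le hμ x]
  exact (ContinuousLinearMap.le_opNorm _ _).trans
    (mul_le_mul (hA.norm_jac_le hLg1 x y) h1 (norm_nonneg _) hLg1)

theorem StepConditions.L1_pos (hS : StepConditions μ Lf1 Lg1 Lg2 Lf0 Cf0 L1 κ α T) (hμ : 0 < μ)
    (hLf1 : 0 < Lf1) (hLg2 : 0 ≤ Lg2) (hLf0 : 0 ≤ Lf0) : 0 < L1 := by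
  rw [hS.L1_eq]; positivity

theorem StepConditions.mem_box_iff (hS : StepConditions μ Lf1 Lg1 Lg2 Lf0 Cf0 L1 κ α T)
    (s : Iterate m n) : s ∈ box f g μ Lf1 Lg2 Lf0 ↔
      ‖s.y - yStar g s.x‖ ≤ min (μ / (2 * Lg2)) (1 / (2 * √L1)) ∧
      ‖s.u - uStar f g s.x‖ ≤ min (5 * L1 / (2 * Lg2)) (√L1 / μ) := by
  rw [hS.L1_eq]; rfl

/-- The set of admissible points is invariant under NBO-CG. -/
theorem Assumptions.nboStep_mem_box (hA : Assumptions f g μ Lf1 Lg1 Lg2 Lf0 Cf0) (hμ : 0 < μ)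
    (hLf1 : 0 < Lf1) (hLg1 : 0 ≤ Lg1) (hLg2 : 0 < Lg2) (hLf0 : 0 ≤ Lf0)
    (hS : StepConditions μ Lf1 Lg1 Lg2 Lf0 Cf0 L1 κ α T) {s : Iterate m n}
    (hs : s ∈ box f g μ Lf1 Lg2 Lf0) : (nboStep f g α T s).val ∈ box f g μ Lf1 Lg2 Lf0 := by
  rw [hS.mem_box_iff] at hs ⊢
  obtain ⟨hy, hu⟩ := hs
  have hL1 := hS.L1_pos hμ hLf1 hLg2.le hLf0
  have hα := hS.α_pos
  have hκ : 0 < κ := by linarith [hS.one_le]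
  have h1 := hA.norm_nboStep_y_le hμ hLg1 hLg2 hS s (hy.trans (min_le_left _ _))
  have h2 := hA.norm_nboStep_u_le hμ hLf1.le hLg1 hLg2.le hLf0 hS s
  have h3 := hA.norm_direction_le hμ hLg1 s.x s.y s.u (hu.trans (min_le_left _ _))
  have h4 : κ * (α * ‖grad1 f s.x s.y - jac12 g s.x s.y s.u‖) ≤ _ :=
    le_trans (by gcongr) hS.move_y
  have h5 : L1 / μ * (2 * κ) * (α * ‖grad1 f s.x s.y - jac12 g s.x s.y s.u‖) ≤ _ :=
    le_trans (by gcongr) hS.move_u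
  have h6 := L1_div_mul_le hμ hLg2 hL1 hy
  -- In units of the radius, y uses 1/2 + 1/2. For u the y-error contributes at most (11/10)(1/2),
  -- and 11/20 + 1/10 + 1/4 < 1.
  refine ⟨by linarith, ?_⟩
  have h7 : L1 / μ * ‖s.y - yStar g s.x‖ ≤ min (5 * L1 / (2 * Lg2)) (√L1 / μ) / 2 := by
    rw [le_div_iff₀ two_pos]
    refine le_min ?_ ?_
    · have h8 := h6.trans (min_le_left _ _)
      have h9 : 0 ≤ L1 / (2 * Lg2) := by positivity
      have : 5 * L1 / (2 * Lg2) = 5 * (L1 / (2 * Lg2)) := by ring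
      linarith
    · have h8 := h6.trans (min_le_right _ _)
      linarith
  have h8 := (norm_nonneg _).trans hu
  linarith

theorem Assumptions.nboCG_mem_box (hA : Assumptions f g μ Lf1 Lg1 Lg2 Lf0 Cf0) (hμ : 0 < μ)
    (hLf1 : 0 < Lf1) (hLg1 : 0 ≤ Lg1) (hLg2 : 0 < Lg2) (hLf0 : 0 ≤ Lf0)
    (hS : StepConditions μ Lf1 Lg1 Lg2 Lf0 Cf0 L1 κ α T) {s : Iterate m n}
    (hs : s ∈ box f g μ Lf1 Lg2 Lf0) (k : ℕ) :
    (nboCG f g α T s k).val ∈ box f g μ Lf1 Lg2 Lf0 := by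
  induction k with
  | zero => exact hs
  | succ k ih =>
    rw [nboCG_succ_val]
    exact hA.nboStep_mem_box hμ hLf1 hLg1 hLg2 hLf0 hS ih

/-- The weighted error of an iterate. -/
def weightedError (f g : Joint m n → ℝ) (Lg1 L1 κ : ℝ) (s : Iterate m n) : ℝ :=
  4 * κ * L1 * ‖s.y - yStar g s.x‖ + Lg1 * ‖s.u - uStar f g s.x‖

/-- The weight 4κL₁ lets the halving of the y-error absorb its leakage into the u-error: 2 + 11/10 ≤
(4/5) · 4. The two drifts sum to 6κ²L₁α, at most 1/10 by `contract`. -/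
theorem Assumptions.weightedError_nboStep_le (hA : Assumptions f g μ Lf1 Lg1 Lg2 Lf0 Cf0)
    (hμ : 0 < μ) (hLf1 : 0 < Lf1) (hLg1 : 0 ≤ Lg1) (hLg2 : 0 < Lg2) (hLf0 : 0 ≤ Lf0)
    (hS : StepConditions μ Lf1 Lg1 Lg2 Lf0 Cf0 L1 κ α T) {s : Iterate m n}
    (hs : s ∈ box f g μ Lf1 Lg2 Lf0) :
    weightedError f g Lg1 L1 κ (nboStep f g α T s).val ≤
      4 / 5 * weightedError f g Lg1 L1 κ s
        + 1 / 10 * ‖grad1 f s.x s.y - jac12 g s.x s.y s.u‖ := by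
  rw [hS.mem_box_iff] at hs
  obtain ⟨hy, hu⟩ := hs
  have hL1 := hS.L1_pos hμ hLf1 hLg2.le hLf0
  have hα := hS.α_pos
  have hκ : 0 < κ := by linarith [hS.one_le]
  have h1 := hA.norm_nboStep_y_le hμ hLg1 hLg2 hS s (hy.trans (min_le_left _ _))
  have h2 := hA.norm_nboStep_u_le hμ hLf1.le hLg1 hLg2.le hLf0 hS s
  have h3 := hS.Lg1_div_le hμ
  set P := ‖s.y - yStar g s.x‖
  set U := ‖s.u - uStar f g s.x‖
  set d := ‖grad1 f s.x s.y - jac12 g s.x s.y s.u‖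
  have hP : 0 ≤ P := norm_nonneg _
  have hU : 0 ≤ U := norm_nonneg _
  have hd : 0 ≤ d := norm_nonneg _
  have h4 : Lg1 * (L1 / μ) ≤ κ * L1 := by
    calc Lg1 * (L1 / μ) = Lg1 / μ * L1 := by ring
      _ ≤ _ := by gcongr
  unfold weightedError
  calc _ ≤ 4 * κ * L1 * (P / 2 + κ * (α * d))
        + Lg1 * (11 / 10 * (L1 / μ * P) + 1 / 10 * U + L1 / μ * (2 * κ) * (α * d)) := by gcongr
    _ = 2 * κ * L1 * P + 4 * (κ ^ 2 * L1 * α) * d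
        + (Lg1 * (L1 / μ)) * (11 / 10 * P + 2 * κ * (α * d)) + 1 / 10 * (Lg1 * U) := by ring
    _ ≤ 2 * κ * L1 * P + 4 * (κ ^ 2 * L1 * α) * d
        + (κ * L1) * (11 / 10 * P + 2 * κ * (α * d)) + 1 / 10 * (Lg1 * U) := by gcongr
    _ = 31 / 10 * (κ * L1 * P) + 6 * (κ ^ 2 * L1 * α) * d + 1 / 10 * (Lg1 * U) := by ring
    _ ≤ _ := by
      have h5 : 6 * (κ ^ 2 * L1 * α) * d ≤ 1 / 10 * d := by
        gcongr
        linarith [hS.contract]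
      have h6 : 0 ≤ κ * L1 * P := by positivity
      have h7 : 0 ≤ Lg1 * U := by positivity
      linarith

/-- This is what the second entries of the minima in `box` are for: they bound the weighted error by
3κ√L₁, so its share of the initial potential is an absolute constant. -/
theorem StepConditions.weightedError_le (hS : StepConditions μ Lf1 Lg1 Lg2 Lf0 Cf0 L1 κ α T)
    (hμ : 0 < μ) (hLf1 : 0 < Lf1) (hLg1 : 0 ≤ Lg1) (hLg2 : 0 < Lg2) (hLf0 : 0 ≤ Lf0)
    {s : Iterate m n} (hs : s ∈ box f g μ Lf1 Lg2 Lf0) :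
    5 / 2 * α * weightedError f g Lg1 L1 κ s ^ 2 ≤ 2 := by
  rw [hS.mem_box_iff] at hs
  obtain ⟨hy, hu⟩ := hs
  have hL1 := hS.L1_pos hμ hLf1 hLg2.le hLf0
  have hα := hS.α_pos
  have hκ : 0 < κ := by linarith [hS.one_le]
  have hs : 0 < √L1 := Real.sqrt_pos.2 hL1
  have h1 : weightedError f g Lg1 L1 κ s ≤ 3 * (κ * √L1) := by
    unfold weightedError
    calc _ ≤ 4 * κ * L1 * (1 / (2 * √L1)) + κ * μ * (√L1 / μ) := by
          gcongr
          · exact hy.trans (min_le_right _ _)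
          · exact hS.Lg1_le
          · exact hu.trans (min_le_right _ _)
      _ = 4 * κ * (√L1 * √L1) * (1 / (2 * √L1)) + κ * μ * (√L1 / μ) := by
          rw [Real.mul_self_sqrt hL1.le]
      _ = _ := by field_simp; ring
  have h0 : 0 ≤ weightedError f g Lg1 L1 κ s := by unfold weightedError; positivity
  calc _ ≤ 5 / 2 * α * (3 * (κ * √L1)) ^ 2 := by gcongr
    _ = 45 / 2 * (κ ^ 2 * L1 * α) := by rw [mul_pow, mul_pow, Real.sq_sqrt hL1.le]; ring
    _ ≤ 2 := by linarith [hS.contract]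

/-- Polarization of -α⟨∇Φ, d⟩ yields the two negative squares and ‖d - ∇Φ‖², which the weighted
error dominates. Half of the -α‖d‖²/2 is given up to cover the quadratic remainder. -/
theorem Assumptions.Phi_nboStep_le (hA : Assumptions f g μ Lf1 Lg1 Lg2 Lf0 Cf0)
    (hμ : 0 < μ) (hLf1 : 0 < Lf1) (hLg1 : 0 ≤ Lg1) (hLg2 : 0 < Lg2) (hLf0 : 0 ≤ Lf0)
    (hS : StepConditions μ Lf1 Lg1 Lg2 Lf0 Cf0 L1 κ α T) (s : Iterate m n) :
    Phi f g (nboStep f g α T s).val.x ≤ Phi f g s.x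
      - α / 2 * ‖hypergradient f g s.x‖ ^ 2
      - α / 4 * ‖grad1 f s.x s.y - jac12 g s.x s.y s.u‖ ^ 2
      + α / 2 * weightedError f g Lg1 L1 κ s ^ 2 := by
  rw [nboStep_val]
  dsimp only
  have hL1 := hS.L1_pos hμ hLf1 hLg2.le hLf0
  have hα := hS.α_pos
  have hκ : 0 < κ := by linarith [hS.one_le]
  have herr := hA.norm_sub_hypergradient_le hμ hLg1 hLg2.le s.x s.y s.u
  set d := grad1 f s.x s.y - jac12 g s.x s.y s.u
  set G := hypergradient f g s.x
  have h1 := (abs_le.1 (hA.abs_Phi_taylor_le hμ hLf1.le hLg2.le hS.one_le (hS.Lg1_div_le hμ)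
    s.x (-(α • d)))).2
  rw [← sub_eq_add_neg, inner_neg_right, inner_smul_right, norm_neg, norm_smul,
    Real.norm_of_nonneg hα.le, ← hS.L1_eq] at h1
  have h2 : ‖d - G‖ ≤ weightedError f g Lg1 L1 κ s := by
    rw [← hS.L1_eq] at herr
    refine herr.trans ?_
    unfold weightedError
    gcongr
    nlinarith [hS.one_le]
  have h3 : ‖d - G‖ ^ 2 ≤ weightedError f g Lg1 L1 κ s ^ 2 := by gcongr
  rw [norm_sub_sq_real, real_inner_comm] at h3
  have h4 : 3 * L1 * κ ^ 2 * (α * ‖d‖) ^ 2 ≤ α / 4 * ‖d‖ ^ 2 := by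
    calc _ = 3 * (κ ^ 2 * L1 * α) * (α * ‖d‖ ^ 2) := by ring
      _ ≤ 1 / 4 * (α * ‖d‖ ^ 2) := by
        gcongr
        linarith [hS.contract]
      _ = _ := by ring
  have h5 : α / 2 * (‖d‖ ^ 2 - 2 * inner ℝ G d + ‖G‖ ^ 2)
      ≤ α / 2 * weightedError f g Lg1 L1 κ s ^ 2 := by gcongr
  linarith

/-- The convergence rate of NBO-CG. -/
theorem Assumptions.minGradLE_nboCG (hA : Assumptions f g μ Lf1 Lg1 Lg2 Lf0 Cf0)
    (hμ : 0 < μ) (hLf1 : 0 < Lf1) (hLg1 : 0 ≤ Lg1) (hLg2 : 0 < Lg2) (hLf0 : 0 ≤ Lf0)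
    (hbdd : BddBelow (range (Phi f g)))
    (hS : StepConditions μ Lf1 Lg1 Lg2 Lf0 Cf0 L1 κ α T) {s : Iterate m n}
    (hs : s ∈ box f g μ Lf1 Lg2 Lf0) {K : ℕ} (hK : 1 ≤ K) :
    minGradLE f g α T s K ((2 * Phi f g s.x - 2 * PhiStar f g + 4) / (α * K)) := by
  have hL1 := hS.L1_pos hμ hLf1 hLg2.le hLf0
  have hκ : 0 < κ := by linarith [hS.one_le]
  have hgrad : gradient (Phi f g) = hypergradient f g :=
    gradient_eq fun x => hA.hasGradientAt_Phi hμ hLf1.le hLg2.le x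
  unfold minGradLE
  rw [hgrad]
  have hmem := fun k => hA.nboCG_mem_box hμ hLf1 hLg1 hLg2 hLf0 hS hs k
  have hsucc := fun k => nboCG_succ_val f g α T s k
  have hzero : (nboCG f g α T s 0).val = s := rfl
  generalize hz : (fun k => (nboCG f g α T s k).val) = z
  have hz' : ∀ k, (nboCG f g α T s k).val = z k := fun k => congrFun hz k
  simp only [hz'] at hmem hsucc hzero ⊢
  have key := exists_norm_sq_le_of_lyapunov (e := fun k => weightedError f g Lg1 L1 κ (z k))
    (d := fun k => ‖grad1 f (z k).x (z k).y - jac12 g (z k).x (z k).y (z k).u‖)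
    (G := fun k => ‖hypergradient f g (z k).x‖) (φ := fun k => Phi f g (z k).x)
    (φs := PhiStar f g) hS.α_pos
    (fun k => by unfold weightedError; positivity)
    (fun k => by
      rw [hsucc]
      exact hA.weightedError_nboStep_le hμ hLf1 hLg1 hLg2 hLf0 hS (hmem k))
    (fun k => by
      rw [hsucc]
      exact hA.Phi_nboStep_le hμ hLf1 hLg1 hLg2 hLf0 hS (z k))
    (fun k => ciInf_le hbdd _)
    (hS.weightedError_le hμ hLf1 hLg1 hLg2 hLf0 (hmem 0)) hK
  rwa [hzero] at key

end Step

/-! ### Oracle costs -/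

section Costs

theorem bind_cost {A B : Type} (c : Counted A) (k : A → Counted B) :
    (c >>= k).cost = ⟨c.cost.grad + (k c.val).cost.grad, c.cost.jac + (k c.val).cost.jac,
      c.cost.hess + (k c.val).cost.hess⟩ := rfl

theorem pure_cost {A : Type} (x : A) : (pure x : Counted A).cost = ⟨0, 0, 0⟩ := rfl

variable {m n : ℕ}

theorem cgStep_cost {O : Vec n → Counted (Vec n)} (hO : ∀ v, (O v).cost = ⟨0, 0, 1⟩)
    (s : CGState n) : (cgStep O s).cost.grad = 0 ∧ (cgStep O s).cost.jac = 0 ∧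
      (cgStep O s).cost.hess ≤ 1 := by
  unfold cgStep
  split_ifs
  · simp [pure_cost]
  · simp [bind_cost, pure_cost, hO]

theorem cg_cost {O : Vec n → Counted (Vec n)} (hO : ∀ v, (O v).cost = ⟨0, 0, 1⟩)
    (b : Vec n) (T : ℕ) : (cg O b T).cost.grad = 0 ∧ (cg O b T).cost.jac = 0 ∧
      (cg O b T).cost.hess ≤ T + 1 := by
  have h : ∀ (s : CGState n) (N : ℕ), (cgIter O s N).cost.grad = 0 ∧
      (cgIter O s N).cost.jac = 0 ∧ (cgIter O s N).cost.hess ≤ N := by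
    intro s N
    induction N with
    | zero => simp [cgIter, pure_cost]
    | succ N ih =>
      have h1 := cgStep_cost hO (cgIter O s N).val
      simp only [cgIter, bind_cost]
      omega
  have h1 := h ⟨0, b, b⟩ (T + 1)
  simp only [cg, bind_cost, pure_cost]
  omega

variable (f g : Joint m n → ℝ)

theorem nboStep_cost (α : ℝ) (T : ℕ) (s : Iterate m n) :
    (nboStep f g α T s).cost.grad = 3 ∧ (nboStep f g α T s).cost.jac = 1 ∧
      (nboStep f g α T s).cost.hess ≤ 2 * T + 3 := by
  have hO : ∀ v, (askHess g s.x s.y v).cost = ⟨0, 0, 1⟩ := fun _ => rfl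
  have h1 := cg_cost hO (grad2 g s.x s.y) T
  have h2 := cg_cost hO (hess22 g s.x s.y s.u - grad2 f s.x s.y) T
  have h3 : (nboStep f g α T s).cost =
      ⟨1 + (0 + (1 + ((cg (askHess g s.x s.y) (grad2 g s.x s.y) T).cost.grad +
          ((cg (askHess g s.x s.y) (hess22 g s.x s.y s.u - grad2 f s.x s.y) T).cost.grad +
            (1 + (0 + 0)))))),
        0 + (0 + (0 + ((cg (askHess g s.x s.y) (grad2 g s.x s.y) T).cost.jac +
          ((cg (askHess g s.x s.y) (hess22 g s.x s.y s.u - grad2 f s.x s.y) T).cost.jac +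
            (0 + (1 + 0)))))),
        0 + (1 + (0 + ((cg (askHess g s.x s.y) (grad2 g s.x s.y) T).cost.hess +
          ((cg (askHess g s.x s.y) (hess22 g s.x s.y s.u - grad2 f s.x s.y) T).cost.hess +
            (0 + (0 + 0))))))⟩ := rfl
  rw [h3]
  refine ⟨?_, ?_, ?_⟩ <;> dsimp only <;> omega

theorem nboCG_cost (α : ℝ) (T : ℕ) (s : Iterate m n) (K : ℕ) :
    (nboCG f g α T s K).cost.grad = 3 * K ∧ (nboCG f g α T s K).cost.jac = K ∧
      (nboCG f g α T s K).cost.hess ≤ (2 * T + 3) * K := by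
  induction K with
  | zero => simp [nboCG, pure_cost]
  | succ K ih =>
    have h1 := nboStep_cost f g α T (nboCG f g α T s K).val
    simp only [nboCG, bind_cost, mul_add, mul_one]
    omega

theorem initY_cost (β : ℝ) (x : Vec m) (y : Vec n) (N : ℕ) :
    (initY g β x y N).cost = ⟨N, 0, 0⟩ := by
  induction N with
  | zero => rfl
  | succ N ih => simp [initY, bind_cost, pure_cost, ih, askGrad2]

theorem initU_cost (β : ℝ) (x : Vec m) (y b u : Vec n) (Q : ℕ) :
    (initU g β x y b u Q).cost = ⟨0, 0, Q⟩ := by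
  induction Q with
  | zero => rfl
  | succ Q ih => simp [initU, bind_cost, pure_cost, ih, askHess]

theorem initBox_cost (β : ℝ) (N Q : ℕ) (s : Iterate m n) :
    (initBox f g β N Q s).cost = ⟨N + 1, 0, Q⟩ := by
  simp [initBox, bind_cost, pure_cost, initY_cost, initU_cost, askGrad2]

theorem fullNboCG_cost (β : ℝ) (N Q : ℕ) (α : ℝ) (T : ℕ) (s : Iterate m n) (K : ℕ) :
    (fullNboCG f g β N Q α T s K).cost.grad = N + 1 + 3 * K ∧
      (fullNboCG f g β N Q α T s K).cost.jac = K ∧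
      (fullNboCG f g β N Q α T s K).cost.hess ≤ Q + (2 * T + 3) * K := by
  have h1 := nboCG_cost f g α T (initBox f g β N Q s).val K
  simp only [fullNboCG, bind_cost, initBox_cost]
  omega

end Costs

/-! ### Initialization -/

section Init

variable {m n : ℕ} {f g : Joint m n → ℝ} {μ Lf1 Lg1 Lg2 Lf0 Cf0 : ℝ}

theorem Assumptions.norm_initY_sub_le (hA : Assumptions f g μ Lf1 Lg1 Lg2 Lf0 Cf0)
    (hμ : 0 < μ) (hμL : μ ≤ Lg1) {β : ℝ} (hβ0 : 0 < β) (hβ : β ≤ 1 / Lg1) (x : Vec m) (y : Vec n)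
    (N : ℕ) : ‖(initY g β x y N).val - yStar g x‖ ^ 2 ≤
      (1 - β * μ) ^ N * ‖y - yStar g x‖ ^ 2 := by
  have hL : 0 < Lg1 := hμ.trans_le hμL
  have hβμ : 0 ≤ 1 - β * μ := by
    have : β * μ ≤ 1 / Lg1 * Lg1 := by gcongr
    rw [one_div_mul_cancel hL.ne'] at this
    linarith
  induction N with
  | zero => simp [initY]
  | succ N ih =>
    have hval : (initY g β x y (N + 1)).val =
      (initY g β x y N).val - β • grad2 g x (initY g β x y N).val := rfl
    rw [hval]
    refine (gradient_step_contraction hL (hA.g_strong x) (hA.hasGradientAt_g x) (fun y z => by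
      have := norm_grad2_sub_le hA.g_grad_lip x x y z
      rwa [norm_pt_sub_right] at this) hβ0 hβ (hA.yStar_le hμ x) _).trans ?_
    rw [pow_succ' (1 - β * μ), mul_assoc]
    gcongr

/-- Each step multiplies the error by 1 - βH, whose spectrum lies in [0, 1 - βμ]. -/
theorem Assumptions.norm_initU_sub_le (hA : Assumptions f g μ Lf1 Lg1 Lg2 Lf0 Cf0)
    (hμ : 0 < μ) (hμL : μ ≤ Lg1) {β : ℝ} (hβ0 : 0 < β) (hβ : β ≤ 1 / Lg1) (x : Vec m)
    (y u : Vec n) {b v : Vec n} (hv : hess22 g x y v = b) (Q : ℕ) :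
    ‖(initU g β x y b u Q).val - v‖ ≤ (1 - β * μ) ^ Q * ‖u - v‖ := by
  have hL : 0 < Lg1 := hμ.trans_le hμL
  have hβL : β * Lg1 ≤ 1 := by rwa [le_div_iff₀ hL] at hβ
  have hβμ : 0 ≤ 1 - β * μ := by
    have : β * μ ≤ β * Lg1 := by gcongr
    linarith
  induction Q with
  | zero => simp [initU]
  | succ Q ih =>
    have hval : (initU g β x y b u (Q + 1)).val = (initU g β x y b u Q).val
      - β • (hess22 g x y (initU g β x y b u Q).val - b) := rfl
    rw [hval]
    have h1 := norm_aeval_le (hA.hess_isSymmetric x y) (hA.hess_coercive x y)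
      (hA.inner_hess_le hL.le x y) (1 - Polynomial.C β * Polynomial.X) (ε := 1 - β * μ)
      (fun t ht => by
        simp only [Polynomial.eval_sub, Polynomial.eval_one, Polynomial.eval_mul,
          Polynomial.eval_C, Polynomial.eval_X]
        have h2 : β * μ ≤ β * t := by gcongr; exact ht.1
        have h3 : β * t ≤ β * Lg1 := by gcongr; exact ht.2
        rw [abs_of_nonneg (by linarith)]
        linarith) ((initU g β x y b u Q).val - v)
    have h2 : Polynomial.aeval (hess22 g x y).toLinearMap (1 - Polynomial.C β * Polynomial.X)
        ((initU g β x y b u Q).val - v) = (initU g β x y b u Q).val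
      - β • (hess22 g x y (initU g β x y b u Q).val - b) - v := by
      rw [← hv, ← map_sub]
      simp only [map_sub, map_one, map_mul, Polynomial.aeval_X, Polynomial.aeval_C]
      simp only [LinearMap.sub_apply, Module.End.one_apply, Module.End.mul_apply,
        Module.algebraMap_end_apply, ContinuousLinearMap.coe_coe, smul_sub]
      abel
    rw [h2] at h1
    refine h1.trans ?_
    rw [pow_succ', mul_assoc]
    gcongr

/-- Adding w itself to the exponent, and using w exp(-w) ≤ 1, avoids a logarithm of w, which may be
zero. -/
theorem one_sub_pow_ceil_mul_le {ρ l w : ℝ} (hρ0 : 0 < ρ) (hρ1 : ρ ≤ 1) (hw : 0 ≤ w) :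
    (1 - ρ) ^ ⌈(l + w) / ρ⌉₊ * w ≤ Real.exp (-l) := by
  have h1 : (1 - ρ) ^ ⌈(l + w) / ρ⌉₊ ≤ Real.exp (-l) * Real.exp (-w) := by
    calc _ ≤ Real.exp (-ρ) ^ ⌈(l + w) / ρ⌉₊ := by
          refine pow_le_pow_left₀ (by linarith) ?_ _
          linarith [Real.add_one_le_exp (-ρ)]
      _ = Real.exp (-(⌈(l + w) / ρ⌉₊ * ρ)) := by rw [← Real.exp_nat_mul]; ring_nf
      _ ≤ Real.exp (-l + -w) := by
          refine Real.exp_le_exp.2 ?_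
          have := Nat.le_ceil ((l + w) / ρ)
          rw [div_le_iff₀ hρ0] at this
          linarith
      _ = _ := Real.exp_add _ _
  have h2 : Real.exp (-w) * w ≤ 1 := by
    have h3 := Real.add_one_le_exp w
    rw [Real.exp_neg, inv_mul_le_iff₀ (Real.exp_pos w)]
    linarith
  calc _ ≤ Real.exp (-l) * Real.exp (-w) * w := by gcongr
    _ = Real.exp (-l) * (Real.exp (-w) * w) := by ring
    _ ≤ Real.exp (-l) * 1 := by gcongr
    _ = _ := mul_one _

theorem ceil_le_mul_log {κ p w r : ℝ} (hκ : 1 ≤ κ) (hp : 0 ≤ p) (hw : 0 ≤ w) (hr : 0 < r) :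
    (⌈(p * Real.log κ + w) / (r / κ)⌉₊ : ℝ) ≤ ((p + w) / r + 1) * (κ * (1 + Real.log κ)) := by
  have hl : 0 ≤ Real.log κ := Real.log_nonneg hκ
  have hκ0 : 0 < κ := by linarith
  have h1 := Nat.ceil_lt_add_one (show 0 ≤ (p * Real.log κ + w) / (r / κ) by positivity)
  have h2 : (p * Real.log κ + w) / (r / κ) ≤ (p + w) / r * (κ * (1 + Real.log κ)) := by
    calc _ = (p * Real.log κ + w) * κ / r := by field_simp
      _ ≤ ((p + w) * (1 + Real.log κ)) * κ / r := by
        gcongr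
        nlinarith
      _ = _ := by ring
  have h3 : 1 ≤ κ * (1 + Real.log κ) := by nlinarith
  linarith

end Init

/-! ### Choice of the constants -/

section Constants

variable {Lf1 Lg1 Lg2 Lf0 Cf0 : ℝ}

/-- Since 1/μ = κ/M, dependence on μ is traded for powers of κ with constants free of μ. -/
theorem L1_le_mul {M μ κ : ℝ} (hLf1 : 0 ≤ Lf1) (hM : 0 < M) (hμ : 0 < μ)
    (hκ : κ = M / μ) (hκ1 : 1 ≤ κ) :
    Lf1 + Lg2 * (Lf0 / μ) ≤ (Lf1 + Lg2 * (Lf0 / M)) * κ := by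
  have h1 : Lg2 * (Lf0 / M) * κ = Lg2 * (Lf0 / μ) := by rw [hκ]; field_simp
  rw [add_mul, h1]
  nlinarith

theorem sqrt_le_sqrt_mul {L c κ : ℝ} (hc : 0 ≤ c) (hκ1 : 1 ≤ κ) (hL : L ≤ c * κ) :
    √L ≤ √c * κ := by
  rw [Real.sqrt_le_left (by positivity), mul_pow, Real.sq_sqrt hc]
  nlinarith [mul_nonneg hc (by nlinarith : 0 ≤ κ ^ 2 - κ)]

theorem exists_stepConditions (hLf1 : 0 < Lf1) (hLg1 : 0 < Lg1) (hLg2 : 0 < Lg2)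
    (hLf0 : 0 ≤ Lf0) (hCf0 : 0 ≤ Cf0) :
    ∃ a : ℝ, 0 < a ∧ ∀ μ : ℝ, 0 < μ → μ ≤ Lg1 → ∀ κ : ℝ, κ = max Lg1 Lf1 / μ →
      ∀ α : ℝ, α = a / κ ^ 3 → ∀ T : ℕ, T = ⌈4 * (√κ * (1 + Real.log κ))⌉₊ →
      StepConditions μ Lf1 Lg1 Lg2 Lf0 Cf0 (Lf1 + Lg2 * (Lf0 / μ)) κ α T := by
  set M := max Lg1 Lf1 with hMdef
  have hM : 0 < M := lt_max_of_lt_left hLg1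
  set c₁ := Lf1 + Lg2 * (Lf0 / M) with hc₁
  set c₂ := Cf0 + Lg1 * (Lf0 / M + 5 * c₁ / (2 * Lg2)) with hc₂
  have hc₁0 : 0 < c₁ := by positivity
  have hc₂0 : 0 < c₂ := by positivity
  -- In the box d has length at most c₂κ. The requirements on a are a·b₁ ≤ 1 for the first entries
  -- of the radii, a·b₂ ≤ 1 for the entries with √L₁, and a·b₃ ≤ 1 for `contract`; the reciprocal of
  -- the sum meets all three.
  set b₁ := 4 * Lg2 * c₂ / M with hb₁
  set b₂ := 8 * c₂ * √c₁ with hb₂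
  set b₃ := 60 * c₁ with hb₃
  have hb₁0 : 0 < b₁ := by positivity
  have hb₂0 : 0 < b₂ := by positivity
  have hb₃0 : 0 < b₃ := by positivity
  refine ⟨1 / (b₁ + b₂ + b₃), by positivity, ?_⟩
  set a := 1 / (b₁ + b₂ + b₃) with ha
  have ha0 : 0 < a := by positivity
  have hab : a * (b₁ + b₂ + b₃) = 1 := by rw [ha]; field_simp
  have hab₁ : a * b₁ ≤ 1 := by nlinarith [mul_pos ha0 hb₂0, mul_pos ha0 hb₃0]
  have hab₂ : a * b₂ ≤ 1 := by nlinarith [mul_pos ha0 hb₁0, mul_pos ha0 hb₃0]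
  have hab₃ : a * b₃ ≤ 1 := by nlinarith [mul_pos ha0 hb₁0, mul_pos ha0 hb₂0]
  rintro μ hμ hμL κ hκ α hα T hT
  have hκ1 : 1 ≤ κ := by
    rw [hκ, le_div_iff₀ hμ, one_mul]
    exact hμL.trans (le_max_left _ _)
  have hκ0 : 0 < κ := by linarith
  have hμκ : μ = M / κ := by rw [hκ]; field_simp
  obtain ⟨L1, hL1⟩ : ∃ L1, L1 = Lf1 + Lg2 * (Lf0 / μ) := ⟨_, rfl⟩
  have hL1le := L1_le_mul (Lg2 := Lg2) (Lf0 := Lf0) hLf1.le hM hμ hκ hκ1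
  rw [← hc₁, ← hL1] at hL1le
  have hL1pos : 0 < L1 := by rw [hL1]; positivity
  have hsL1 : 0 < √L1 := Real.sqrt_pos.2 hL1pos
  have hsqrt : √L1 ≤ √c₁ * κ := sqrt_le_sqrt_mul hc₁0.le hκ1 hL1le
  rw [← hL1]
  have hα0 : 0 < α := by rw [hα]; positivity
  have hmove : α * (Cf0 + Lg1 * (Lf0 / μ + 5 * L1 / (2 * Lg2))) ≤ a * c₂ / κ ^ 2 := by
    have h1 : Cf0 + Lg1 * (Lf0 / μ + 5 * L1 / (2 * Lg2)) ≤ c₂ * κ := by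
      have h2 : Lf0 / μ = Lf0 / M * κ := by rw [hκ]; field_simp
      calc Cf0 + Lg1 * (Lf0 / μ + 5 * L1 / (2 * Lg2))
          ≤ Cf0 * κ + Lg1 * (Lf0 / M * κ + 5 * (c₁ * κ) / (2 * Lg2)) := by
            rw [h2]
            gcongr
            nlinarith
        _ = c₂ * κ := by rw [hc₂]; ring
    calc _ ≤ α * (c₂ * κ) := by gcongr
      _ = _ := by rw [hα]; field_simp
  refine ⟨hL1, hκ1, ?_, hα0, ?_, ?_, ?_, ?_⟩
  · rw [hκ, div_mul_cancel₀ _ hμ.ne']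
    exact le_max_left _ _
  · rw [hT]; exact Nat.le_ceil _
  · have h1 : κ * (α * (Cf0 + Lg1 * (Lf0 / μ + 5 * L1 / (2 * Lg2)))) ≤ a * c₂ / κ := by
      calc _ ≤ κ * (a * c₂ / κ ^ 2) := by gcongr
        _ = _ := by field_simp
    refine h1.trans ?_
    rw [le_div_iff₀ two_pos]
    refine le_min ?_ ?_
    · have h2 : a * c₂ ≤ M / (4 * Lg2) := by
        rw [le_div_iff₀ (by positivity)]
        rw [hb₁, mul_div_assoc', div_le_one hM] at hab₁
        linarith
      calc a * c₂ / κ * 2 ≤ M / (4 * Lg2) / κ * 2 := by gcongr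
        _ = _ := by rw [hμκ]; field_simp; ring
    · rw [le_div_iff₀ (by positivity)]
      calc a * c₂ / κ * 2 * (2 * √L1) ≤ a * c₂ / κ * 2 * (2 * (√c₁ * κ)) := by gcongr
        _ = a * b₂ / 2 := by rw [hb₂]; field_simp; ring
        _ ≤ 1 := by linarith
  · have h1 : L1 / μ * (2 * κ) * (α * (Cf0 + Lg1 * (Lf0 / μ + 5 * L1 / (2 * Lg2))))
        ≤ 2 * L1 * (a * c₂) / M := by
      calc _ ≤ L1 / μ * (2 * κ) * (a * c₂ / κ ^ 2) := by gcongr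
        _ = _ := by rw [hμκ]; field_simp
    refine h1.trans ?_
    rw [le_div_iff₀ four_pos]
    refine le_min ?_ ?_
    · calc 2 * L1 * (a * c₂) / M * 4 = 2 * L1 / Lg2 * (a * b₁) := by rw [hb₁]; field_simp
        _ ≤ 2 * L1 / Lg2 * 1 := by gcongr
        _ = 4 * L1 / (2 * Lg2) := by field_simp; ring
        _ ≤ _ := by gcongr; norm_num
    · have h2 : √L1 / μ = √L1 * κ / M := by rw [hμκ]; field_simp
      rw [h2]
      calc 2 * L1 * (a * c₂) / M * 4 = √L1 * (8 * (a * c₂) * √L1) / M := by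
            nth_rewrite 1 [← Real.mul_self_sqrt hL1pos.le]
            ring
        _ ≤ √L1 * (8 * (a * c₂) * (√c₁ * κ)) / M := by gcongr
        _ = √L1 * (a * b₂ * κ) / M := by rw [hb₂]; ring
        _ ≤ √L1 * (1 * κ) / M := by gcongr
        _ = _ := by rw [one_mul]
  · calc 60 * (κ ^ 2 * L1 * α) ≤ 60 * (κ ^ 2 * (c₁ * κ) * α) := by gcongr
      _ = a * b₃ := by rw [hα, hb₃]; field_simp
      _ ≤ 1 := hab₃

/-- The initialization yields an admissible point after `O(κ (1 + log κ))` steps. -/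
theorem exists_initBox_mem_box (hLf1 : 0 < Lf1) (hLg1 : 0 < Lg1) (hLg2 : 0 < Lg2)
    (hLf0 : 0 ≤ Lf0) (R : ℝ) {β : ℝ} (hβ0 : 0 < β) (hβ : β ≤ 1 / Lg1) :
    ∃ C : ℝ, 0 < C ∧ ∀ μ : ℝ, 0 < μ → μ ≤ Lg1 → ∀ κ : ℝ, κ = max Lg1 Lf1 / μ →
      ∃ N Q : ℕ, (N : ℝ) ≤ C * (κ * (1 + Real.log κ)) ∧ (Q : ℝ) ≤ C * (κ * (1 + Real.log κ)) ∧
      ∀ (m n : ℕ) (f g : Joint m n → ℝ), Assumptions f g μ Lf1 Lg1 Lg2 Lf0 Cf0 →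
        ∀ s : Iterate m n, ‖grad2 g s.x s.y‖ ≤ R → ‖s.u‖ ≤ R →
          (initBox f g β N Q s).val ∈ box f g μ Lf1 Lg2 Lf0 := by
  set M := max Lg1 Lf1 with hMdef
  have hM : 0 < M := lt_max_of_lt_left hLg1
  set c₁ := Lf1 + Lg2 * (Lf0 / M) with hc₁
  have hc₁0 : 0 < c₁ := by positivity
  -- The radius for y is at least cy/κ. The constant `cu` bounds from below what remains of the
  -- radius for u once the effect of the inexact y on the linear system is subtracted.
  set cy := min (M / (2 * Lg2)) (1 / (2 * √c₁)) with hcy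
  have hcy0 : 0 < cy := by
    have := Real.sqrt_pos.2 hc₁0
    exact lt_min (by positivity) (by positivity)
  set cu := min (2 * Lf1 / Lg2) (√Lf1 / (2 * Lg1)) with hcu
  have hcu0 : 0 < cu := by
    have := Real.sqrt_pos.2 hLf1
    exact lt_min (by positivity) (by positivity)
  set R' := max R 0 with hR'
  have hR'0 : 0 ≤ R' := le_max_right _ _
  -- The y-error must fall from R'κ/M to cy/κ, a squared ratio of wy·κ⁴, hence 4 log κ below. The
  -- u-error must fall from κW to cu, a ratio of wu·κ, hence log κ.
  set wy := (R' / M / cy) ^ 2 with hwy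
  set W := R' + Lf0 / M + c₁ / (2 * Lg2) with hW
  have hW0 : 0 ≤ W := by positivity
  set wu := W / cu with hwu
  have hwy0 : 0 ≤ wy := by positivity
  have hwu0 : 0 ≤ wu := by positivity
  refine ⟨((4 + wy) / (β * M) + 1) + ((1 + wu) / (β * M) + 1), by positivity, ?_⟩
  rintro μ hμ hμL κ hκ
  have hκ1 : 1 ≤ κ := by
    rw [hκ, le_div_iff₀ hμ, one_mul]
    exact hμL.trans (le_max_left _ _)
  have hκ0 : 0 < κ := by linarith
  have hμκ : μ = M / κ := by rw [hκ]; field_simp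
  have hβμ : β * μ = β * M / κ := by rw [hμκ]; ring
  have hl : 0 ≤ Real.log κ := Real.log_nonneg hκ1
  have hN := ceil_le_mul_log hκ1 (p := 4) (by norm_num) hwy0 (mul_pos hβ0 hM)
  have hQ := ceil_le_mul_log hκ1 (p := 1) (by norm_num) hwu0 (mul_pos hβ0 hM)
  rw [← hβμ] at hN hQ
  have hβμ0 : 0 < β * μ := by positivity
  have hβμ1 : β * μ ≤ 1 := by
    have : β * μ ≤ 1 / Lg1 * Lg1 := by gcongr
    rwa [one_div_mul_cancel hLg1.ne'] at this
  have hdy := one_sub_pow_ceil_mul_le (l := 4 * Real.log κ) hβμ0 hβμ1 hwy0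
  have hdu := one_sub_pow_ceil_mul_le (l := 1 * Real.log κ) hβμ0 hβμ1 hwu0
  generalize ⌈(4 * Real.log κ + wy) / (β * μ)⌉₊ = N at hN hdy
  generalize ⌈(1 * Real.log κ + wu) / (β * μ)⌉₊ = Q at hQ hdu
  refine ⟨N, Q, ?_, ?_, ?_⟩
  · have : 0 ≤ ((1 + wu) / (β * M) + 1) * (κ * (1 + Real.log κ)) := by positivity
    linarith
  · have : 0 ≤ ((4 + wy) / (β * M) + 1) * (κ * (1 + Real.log κ)) := by positivity
    linarith
  intro m n f g hA s hsR huR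
  obtain ⟨L1, hL1⟩ : ∃ L1, L1 = Lf1 + Lg2 * (Lf0 / μ) := ⟨_, rfl⟩
  have hL1le := L1_le_mul (Lg2 := Lg2) (Lf0 := Lf0) hLf1.le hM hμ hκ hκ1
  rw [← hc₁, ← hL1] at hL1le
  have hL1pos : 0 < L1 := by rw [hL1]; positivity
  have hsL1 : 0 < √L1 := Real.sqrt_pos.2 hL1pos
  have hLfL1 : Lf1 ≤ L1 := by
    rw [hL1]
    have : 0 ≤ Lg2 * (Lf0 / μ) := by positivity
    linarith
  have hsqrt : √L1 ≤ √c₁ * κ := sqrt_le_sqrt_mul hc₁0.le hκ1 hL1le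
  set y := (initY g β s.x s.y N).val with hy
  set u := (initU g β s.x y (grad2 f s.x y) s.u Q).val with hu
  have hval : (initBox f g β N Q s).val = ⟨s.x, y, u⟩ := rfl
  have hydist : ‖y - yStar g s.x‖ ≤ min (μ / (2 * Lg2)) (1 / (2 * √L1)) := by
    have h1 := hA.norm_initY_sub_le hμ hμL hβ0 hβ s.x s.y N
    have h2 : ‖s.y - yStar g s.x‖ ≤ R' * κ / M := by
      have h3 := hA.norm_sub_yStar_le hμ s.x s.y
      have h4 : μ * ‖s.y - yStar g s.x‖ ≤ R' := h3.trans (hsR.trans (le_max_left _ _))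
      rw [hμκ, div_mul_eq_mul_div, div_le_iff₀ hκ0] at h4
      rw [le_div_iff₀ hM]
      linarith
    have h5 : ‖y - yStar g s.x‖ ^ 2 ≤ (cy / κ) ^ 2 := by
      calc _ ≤ (1 - β * μ) ^ N * ‖s.y - yStar g s.x‖ ^ 2 := h1
        _ ≤ (1 - β * μ) ^ N * (R' * κ / M) ^ 2 := by
            have : 0 ≤ 1 - β * μ := by linarith
            gcongr
        _ = (1 - β * μ) ^ N * wy * (cy * κ) ^ 2 := by rw [hwy]; field_simp
        _ ≤ Real.exp (-(4 * Real.log κ)) * (cy * κ) ^ 2 := by gcongr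
        _ = (κ ^ 4)⁻¹ * (cy * κ) ^ 2 := by
            rw [Real.exp_neg, ← Real.exp_log (pow_pos hκ0 4), Real.log_pow]
            norm_num
        _ = _ := by field_simp
    have h6 : ‖y - yStar g s.x‖ ≤ cy / κ := le_of_sq_le_sq h5 (by positivity)
    refine h6.trans (le_min ?_ ?_)
    · calc cy / κ ≤ M / (2 * Lg2) / κ := by gcongr; exact min_le_left _ _
        _ = _ := by rw [hμκ]; field_simp
    · have hsc := Real.sqrt_pos.2 hc₁0
      calc cy / κ ≤ 1 / (2 * √c₁) / κ := by gcongr; exact min_le_right _ _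
        _ = 1 / (2 * (√c₁ * κ)) := by field_simp
        _ ≤ _ := by gcongr
  have hudist : ‖u - uStar f g s.x‖ ≤ min (5 * L1 / (2 * Lg2)) (√L1 / μ) := by
    obtain ⟨v, hv⟩ := hA.exists_hess_eq hμ s.x y (grad2 f s.x y)
    have h1 := hA.norm_initU_sub_le hμ hμL hβ0 hβ s.x y s.u hv Q
    have h2 := hA.norm_sub_uStar_le hμ hLg2.le s.x s.x y v hv
    rw [norm_pt_sub_right, ← hL1] at h2
    have h3 := h2.trans (L1_div_mul_le hμ hLg2 hL1pos hydist)
    have h4 : ‖s.u - v‖ ≤ κ * W := by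
      have h5 : ‖s.u - v‖ ≤ ‖s.u‖ + (‖uStar f g s.x‖ + ‖v - uStar f g s.x‖) := by
        refine (norm_sub_le _ _).trans ?_
        have : v = uStar f g s.x + (v - uStar f g s.x) := by abel
        conv_lhs => rw [this]
        gcongr
        exact norm_add_le _ _
      have h6 := h3.trans (min_le_left _ _)
      have h7 := hA.norm_uStar_le hμ s.x
      have h8 : Lf0 / μ = Lf0 / M * κ := by rw [hκ]; field_simp
      have h9 : ‖s.u‖ ≤ R' * κ := by
        have : R' * 1 ≤ R' * κ := by gcongr
        linarith [huR.trans (le_max_left R 0)]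
      have h10 : L1 / (2 * Lg2) ≤ c₁ / (2 * Lg2) * κ := by
        calc _ ≤ c₁ * κ / (2 * Lg2) := by gcongr
          _ = _ := by ring
      rw [hW]
      linarith
    have h5 : ‖u - v‖ ≤ cu := by
      calc _ ≤ (1 - β * μ) ^ Q * ‖s.u - v‖ := h1
        _ ≤ (1 - β * μ) ^ Q * (κ * W) := by
            have : 0 ≤ 1 - β * μ := by linarith
            gcongr
        _ = (1 - β * μ) ^ Q * wu * (cu * κ) := by rw [hwu]; field_simp
        _ ≤ Real.exp (-(1 * Real.log κ)) * (cu * κ) := by gcongr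
        _ = cu := by rw [one_mul, Real.exp_neg, Real.exp_log hκ0]; field_simp
    have h6 : cu ≤ 2 * L1 / Lg2 := by
      calc cu ≤ 2 * Lf1 / Lg2 := min_le_left _ _
        _ ≤ _ := by gcongr
    have h7 : cu ≤ √L1 / μ / 2 := by
      calc cu ≤ √Lf1 / (2 * Lg1) := min_le_right _ _
        _ ≤ √L1 / (2 * μ) := by gcongr
        _ = _ := by field_simp
    have h8 : ‖u - uStar f g s.x‖ ≤ ‖u - v‖ + ‖v - uStar f g s.x‖ := norm_sub_le_norm_sub_add_norm_sub _ _ _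
    refine le_min ?_ ?_
    · have h9 := h3.trans (min_le_left _ _)
      have h10 : 5 * L1 / (2 * Lg2) = 2 * L1 / Lg2 + L1 / (2 * Lg2) := by field_simp; ring
      linarith
    · have h9 := h3.trans (min_le_right _ _)
      linarith
  rw [hval]
  unfold box
  rw [← hL1]
  exact ⟨hydist, hudist⟩

end Constants

/-! ### Iteration and oracle complexity -/

/-- Enough outer iterations for accuracy `ε`, and the resulting oracle complexity. -/
theorem exists_iterations {a D N C₀ κ ε : ℝ} (ha : 0 < a) (hD : 0 ≤ D) (hκ : 1 ≤ κ)
    (hε0 : 0 < ε) (hε1 : ε ≤ 1) (hN0 : 0 ≤ N) (hN : N ≤ C₀ * (κ * (1 + Real.log κ)))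
    {T : ℕ} (hT : T = ⌈4 * (√κ * (1 + Real.log κ))⌉₊) {C : ℝ}
    (hC : C₀ + 1 + 13 * ((2 * D + 4) / a + 1) ≤ C) :
    ∃ K : ℕ, 1 ≤ K ∧ (K : ℝ) ≤ C * (κ ^ 3 / ε) ∧ (2 * D + 4) / (a / κ ^ 3 * K) ≤ ε ∧
      N + 1 + 3 * K ≤ C * (κ ^ 3 / ε) ∧
      N + (2 * T + 3) * K ≤ C * (κ ^ (7 / 2 : ℝ) * (1 + Real.log κ) / ε) := by
  have hκ0 : 0 < κ := by linarith
  have hl : 0 ≤ Real.log κ := Real.log_nonneg hκ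
  have hlκ : 1 + Real.log κ ≤ κ := by linarith [Real.log_le_sub_one_of_pos hκ0]
  have hs1 : 1 ≤ √κ := Real.one_le_sqrt.2 hκ
  have hpow : κ ^ (7 / 2 : ℝ) = κ ^ 3 * √κ := by
    rw [Real.sqrt_eq_rpow, ← Real.rpow_natCast, ← Real.rpow_add hκ0]
    norm_num
  have hX1 : 1 ≤ κ ^ 3 / ε := by
    rw [le_div_iff₀ hε0, one_mul]
    exact hε1.trans (one_le_pow₀ hκ)
  set X := κ ^ 3 / ε with hX
  set B := (2 * D + 4) / a with hB
  have hB0 : 0 < B := by positivity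
  have hBX : 0 < B * X := by positivity
  have hK := Nat.le_ceil (B * X)
  have hK2 := Nat.ceil_lt_add_one hBX.le
  have hK1 : 1 ≤ ⌈B * X⌉₊ := Nat.one_le_ceil_iff.2 hBX
  generalize ⌈B * X⌉₊ = K at hK hK2 hK1
  have hKX : (K : ℝ) ≤ (B + 1) * X := by linarith
  have hC₀ : 0 ≤ C₀ := by
    by_contra! hneg
    have : 0 < κ * (1 + Real.log κ) := by positivity
    nlinarith
  -- The initialization is dominated by the outer loop: 1 + log κ ≤ κ, and ε ≤ 1.
  have hNX : N ≤ C₀ * X := by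
    have h1 : κ * (1 + Real.log κ) ≤ X := by
      rw [hX, le_div_iff₀ hε0]
      calc κ * (1 + Real.log κ) * ε ≤ κ * κ * 1 := by gcongr
        _ ≤ κ * κ * κ := by gcongr
        _ = _ := by ring
    exact hN.trans (by gcongr)
  have hY : κ ^ (7 / 2 : ℝ) * (1 + Real.log κ) / ε = X * (√κ * (1 + Real.log κ)) := by
    rw [hpow, hX]; ring
  have hY1 : 1 ≤ √κ * (1 + Real.log κ) := by nlinarith
  rw [hY]
  set Y := √κ * (1 + Real.log κ) with hYdef
  have hT2 : (T : ℝ) ≤ 4 * Y + 1 := by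
    rw [hT]
    exact (Nat.ceil_lt_add_one (by positivity)).le
  have hX0 : 0 < X := by positivity
  have hBX3 : (B + 1) * X ≤ C * X := by gcongr; linarith
  refine ⟨K, hK1, hKX.trans hBX3, ?_, ?_, ?_⟩
  · have hK0 : (0 : ℝ) < K := by exact_mod_cast hK1
    have h1 : (2 * D + 4) / (a / κ ^ 3 * K) = B * X * ε / K := by
      rw [hB, hX]; field_simp
    rw [h1, div_le_iff₀ hK0, mul_comm ε]
    gcongr
  · calc N + 1 + 3 * K ≤ C₀ * X + X + 3 * ((B + 1) * X) := by gcongr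
      _ = (C₀ + 1 + 3 * (B + 1)) * X := by ring
      _ ≤ C * X := by gcongr; linarith
  · calc N + (2 * T + 3) * K ≤ C₀ * X + (2 * (4 * Y + 1) + 3) * ((B + 1) * X) := by gcongr
      -- Since Y ≥ 1, the 8Y + 5 Hessian-vector products per outer iteration are at most 13Y.
      _ ≤ C₀ * X * Y + (13 * Y) * ((B + 1) * X) := by
        refine add_le_add (le_mul_of_one_le_right (by positivity) hY1) ?_
        gcongr
        linarith
      _ = (C₀ + 13 * (B + 1)) * (X * Y) := by ring
      _ ≤ C * (X * Y) := by gcongr; linarith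

theorem minGradLE.mono {m n : ℕ} {f g : Joint m n → ℝ} {α : ℝ} {T : ℕ} {s : Iterate m n} {K : ℕ}
    {B B' : ℝ} (h : minGradLE f g α T s K B) (hB : B ≤ B') : minGradLE f g α T s K B' := by
  obtain ⟨k, hk, hkB⟩ := h
  exact ⟨k, hk, hkB.trans hB⟩

end Bilevel

end

/-! ### Assembly of the rate, the oracle counts and the initialization. -/

open Bilevel in
theorem mainTheorem3
    (Lf1 Lg1 Lg2 Lf0 Cf0 : ℝ) (hLf1 : 0 < Lf1) (hLg1 : 0 < Lg1) (hLg2 : 0 < Lg2)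
    (hLf0 : 0 ≤ Lf0) (hCf0 : 0 ≤ Cf0) :
    ∃ a τ : ℝ, 0 < a ∧ 0 < τ ∧
    ∀ D R β : ℝ, 0 < β → β ≤ 1 / Lg1 →
    ∃ C : ℝ, 0 < C ∧
    ∀ μ : ℝ, 0 < μ → μ ≤ Lg1 →
    ∀ κ : ℝ, κ = max Lg1 Lf1 / μ →
    ∀ α : ℝ, α = a / κ ^ 3 →
    ∀ T : ℕ, T = ⌈τ * (√κ * (1 + Real.log κ))⌉₊ →
    ∃ N Q : ℕ, (N : ℝ) ≤ C * (κ * (1 + Real.log κ)) ∧ (Q : ℝ) ≤ C * (κ * (1 + Real.log κ)) ∧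
    ∀ (m n : ℕ) (f g : Joint m n → ℝ), Assumptions f g μ Lf1 Lg1 Lg2 Lf0 Cf0 →
      BddBelow (Set.range (Phi f g)) →
      Differentiable ℝ (Phi f g) ∧
      -- convergence rate from every admissible initial point
      (∀ s ∈ box f g μ Lf1 Lg2 Lf0, ∀ K : ℕ, 1 ≤ K →
        minGradLE f g α T s K ((2 * Phi f g s.x - 2 * PhiStar f g + 4) / (α * K)) ∧
        (Phi f g s.x - PhiStar f g ≤ D → minGradLE f g α T s K (C * (κ ^ 3 / K)))) ∧
      -- complexity from every admissible initial point
      (∀ s ∈ box f g μ Lf1 Lg2 Lf0, Phi f g s.x - PhiStar f g ≤ D →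
        ∀ ε : ℝ, 0 < ε → ε ≤ 1 → ∃ K : ℕ, 1 ≤ K ∧ (K : ℝ) ≤ C * (κ ^ 3 / ε) ∧
          minGradLE f g α T s K ε ∧
          ((nboCG f g α T s K).cost.grad : ℝ) ≤ C * (κ ^ 3 / ε) ∧
          ((nboCG f g α T s K).cost.jac : ℝ) ≤ C * (κ ^ 3 / ε) ∧
          ((nboCG f g α T s K).cost.hess : ℝ) ≤
            C * (κ ^ (7 / 2 : ℝ) * (1 + Real.log κ) / ε)) ∧
      -- total complexity, with the computation of an admissible initial point included
      (∀ s : Iterate m n, ‖grad2 g s.x s.y‖ ≤ R → ‖s.u‖ ≤ R →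
        (initBox f g β N Q s).val ∈ box f g μ Lf1 Lg2 Lf0 ∧
        (Phi f g s.x - PhiStar f g ≤ D →
          ∀ ε : ℝ, 0 < ε → ε ≤ 1 → ∃ K : ℕ, 1 ≤ K ∧ (K : ℝ) ≤ C * (κ ^ 3 / ε) ∧
            minGradLE f g α T (initBox f g β N Q s).val K ε ∧
            ((fullNboCG f g β N Q α T s K).cost.grad : ℝ) ≤ C * (κ ^ 3 / ε) ∧
            ((fullNboCG f g β N Q α T s K).cost.jac : ℝ) ≤ C * (κ ^ 3 / ε) ∧
            ((fullNboCG f g β N Q α T s K).cost.hess : ℝ) ≤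
              C * (κ ^ (7 / 2 : ℝ) * (1 + Real.log κ) / ε))) := by
  obtain ⟨a, ha, hstep⟩ := exists_stepConditions hLf1 hLg1 hLg2 hLf0 hCf0
  refine ⟨a, 4, ha, by norm_num, fun D R β hβ0 hβ => ?_⟩
  obtain ⟨C₀, hC₀, hinit⟩ :=
    exists_initBox_mem_box (Cf0 := Cf0) hLf1 hLg1 hLg2 hLf0 R hβ0 hβ
  set D' := max D 0 with hD'
  have hD'0 : 0 ≤ D' := le_max_right _ _
  have hB0 : 0 < (2 * D' + 4) / a := by positivity
  -- The factor 2 appears because N + Q is charged to the gradient and the Hessian count alike.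
  obtain ⟨C, hC⟩ : ∃ C, C = 2 * C₀ + 1 + 13 * ((2 * D' + 4) / a + 1) := ⟨_, rfl⟩
  have hC0 : 0 < C := by rw [hC]; positivity
  refine ⟨C, hC0, fun μ hμ hμL κ hκ α hα T hT => ?_⟩
  obtain ⟨N, Q, hN, hQ, hbox⟩ := hinit μ hμ hμL κ hκ
  have hS := hstep μ hμ hμL κ hκ α hα T hT
  have hκ1 := hS.one_le
  have hκ0 : 0 < κ := by linarith
  have hκl : 0 ≤ κ * (1 + Real.log κ) := by
    have := Real.log_nonneg hκ1
    positivity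
  have hC₀C : C₀ * (κ * (1 + Real.log κ)) ≤ C * (κ * (1 + Real.log κ)) := by
    gcongr
    linarith
  refine ⟨N, Q, hN.trans hC₀C, hQ.trans hC₀C, fun m n f g hA hbdd => ?_⟩
  have hrate : ∀ s ∈ box f g μ Lf1 Lg2 Lf0, ∀ K : ℕ, 1 ≤ K →
      minGradLE f g α T s K ((2 * Phi f g s.x - 2 * PhiStar f g + 4) / (α * K)) :=
    fun s hs K hK => hA.minGradLE_nboCG hμ hLf1 hLg1.le hLg2 hLf0 hbdd hS hs hK
  have hrateD : ∀ s ∈ box f g μ Lf1 Lg2 Lf0, Phi f g s.x - PhiStar f g ≤ D → ∀ K : ℕ, 1 ≤ K →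
      minGradLE f g α T s K ((2 * D' + 4) / (α * K)) := by
    intro s hs hsD K hK
    have hα0 := hS.α_pos
    refine (hrate s hs K hK).mono ?_
    gcongr
    linarith [le_max_left D 0]
  refine ⟨fun x => (hA.hasGradientAt_Phi hμ hLf1.le hLg2.le x).differentiableAt,
    fun s hs K hK => ⟨hrate s hs K hK, fun hsD => ?_⟩, ?_, ?_⟩
  · refine (hrateD s hs hsD K hK).mono ?_
    have hK0 : (0 : ℝ) < K := by exact_mod_cast hK
    calc (2 * D' + 4) / (α * K) = (2 * D' + 4) / a * (κ ^ 3 / K) := by rw [hα]; field_simp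
      _ ≤ C * (κ ^ 3 / K) := by gcongr; linarith
  · intro s hs hsD ε hε0 hε1
    obtain ⟨K, hK1, hK2, hK3, hK4, hK5⟩ := exists_iterations (N := 0) (C₀ := C₀) (C := C) ha
      hD'0 hκ1 hε0 hε1 le_rfl (by positivity) hT (by linarith)
    obtain ⟨h1, h2, h3⟩ := nboCG_cost f g α T s K
    have h3' : ((nboCG f g α T s K).cost.hess : ℝ) ≤ (2 * T + 3) * K := by exact_mod_cast h3
    refine ⟨K, hK1, hK2, (hrateD s hs hsD K hK1).mono (by rwa [hα]), ?_, ?_, ?_⟩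
    · rw [h1]; push_cast; linarith
    · rw [h2]; exact hK2
    · linarith
  · intro s hsR huR
    have hmem := hbox m n f g hA s hsR huR
    refine ⟨hmem, fun hsD ε hε0 hε1 => ?_⟩
    obtain ⟨K, hK1, hK2, hK3, hK4, hK5⟩ := exists_iterations (N := (N : ℝ) + Q)
      (C₀ := 2 * C₀) ha hD'0 hκ1 hε0 hε1 (by positivity) (by linarith) hT (C := C)
      hC.ge
    obtain ⟨h1, h2, h3⟩ := fullNboCG_cost f g β N Q α T s K
    have h3' : ((fullNboCG f g β N Q α T s K).cost.hess : ℝ) ≤ Q + (2 * T + 3) * K := by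
      exact_mod_cast h3
    have hN0 : (0 : ℝ) ≤ N := N.cast_nonneg
    have hQ0 : (0 : ℝ) ≤ Q := Q.cast_nonneg
    -- The initialization leaves x unchanged, so the bound on Φ(x⁰) - Φ* carries over as it is.
    refine ⟨K, hK1, hK2, (hrateD _ hmem hsD K hK1).mono (by rwa [hα]), ?_, ?_, ?_⟩
    · rw [h1]; push_cast; linarith
    · rw [h2]; exact hK2
    · linarith
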